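/- Let $\gamma=(\gamma_u)$ be non-negative weights indexed by the finite subsets $u$ of $\{1,2,\dots\}$. For $d\in\mathbb N$ let $H_{d,\gamma}$ be the weighted unanchored Sobolev space of smoothness $1$: the continuous functions $f:[0,1)^d\to\mathbb R$ all of whose weak mixed derivatives $\partial^{|u|}f/\partial x_u$, $u\subseteq\{1,\dots,d\}$ (one derivative in each variable $x_j$, $j\in u$), lie in $L^2$, and for which $$\|f\|_{d,\gamma}^2=\sum_{u\subseteq\{1,\dots,d\}}\frac1{\gamma_u}\int_{[0,1)^{|u|}}\Bigl(\int_{[0,1)^{d-|u|}}\frac{\partial^{|u|}f}{\partial x_u}\,dx_{\{1,\dots,d\}\setminus u}\Bigr)^2dx_u<\infty ,$$ with the convention $0/0=0$ (so the inner integral has to vanish almost everywhere when $\gamma_u=0$). For a positive integer $n$ and $z\in\{1,\dots,n-1\}^d$ let $$e_d(n,z)=\sup_{\|f\|_{d,\gamma}\le1}\Bigl|\int_{[0,1)^d}f(x)\,dx-\frac1n\sum_{i=0}^{n-1}f\bigl(\{iz_1/n\},\dots,\{iz_d/n\}\bigr)\Bigr|$$ be the worst-case error of the unshifted rank-1 lattice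 rule with generating vector $z$, where $\{\cdot\}$ is the fractional part, and put $$C_u=\frac{2}{3^{|u|}}+\frac1{4^{|u|}}+4\Bigl(\frac{23}{24}\Bigr)^{|u|}+\Bigl(\frac3{\pi^2}+\frac56\Bigr)^{|u|}.$$ (a) For every $d$ and every odd prime $n$, $$\frac1{(n-1)^d}\sum_{z\in\{1,\dots,n-1\}^d}e_d(n,z)^2\le\frac{\log n}{\sqrt n}\sum_{\emptyset\ne u\subseteq\{1,\dots,d\}}\gamma_uC_u ,$$ and hence some $z\in\{1,\dots,n-1\}^d$ satisfies $$e_d(n,z)\le\Bigl(\frac{\log n}{\sqrt n}\sum_{\emptyset\ne u\subseteq\{1,\dots,d\}}\gamma_uC_u\Bigr)^{1/2}.$$ (b) If $\sum_{|u|<\infty}\gamma_uC_u<\infty$, then, with $C=\sum_{\emptyset\ne u,\ |u|<\infty}\gamma_uC_u$, which depends neither on $d$ nor on $n$, for every $d$ and every odd prime $n$ some $z\in\{1,\dots,n-1\}^d$ satisfies $$e_d(n,z)\le\sqrt C\;n^{-1/4}(\log n)^{1/2}.$$ (c) For product weights $\gamma_u=\prod_{j\in u}\gamma_j$ with $\gamma_j\ge0$,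 the condition $\sum_{|u|<\infty}\gamma_uC_u<\infty$ is equivalent to $\sum_{j=1}^\infty\gamma_j<\infty$. -/

import Mathlib

open MeasureTheory
open scoped ENNReal

noncomputable section

namespace LatticeQMC

/-- The half-open unit cube `[0,1)^d`. Coordinates are labelled `0, …, d - 1`. -/
def unitCube (d : ℕ) : Set (Fin d → ℝ) := Set.univ.pi fun _ => Set.Ico (0 : ℝ) 1

/-- The open unit cube `(0,1)^d`. -/
def openCube (d : ℕ) : Set (Fin d → ℝ) := Set.univ.pi fun _ => Set.Ioo (0 : ℝ) 1

/-- The classical mixed partial derivative `∂^{|u|} φ / ∂x_u`, once in each variable `j ∈ u`. -/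
def mixedPartial {d : ℕ} (u : Finset (Fin d)) (φ : (Fin d → ℝ) → ℝ) : (Fin d → ℝ) → ℝ :=
  (u.sort (· ≤ ·)).foldr (fun j g x => lineDeriv ℝ g x (Pi.single j 1)) φ

/-- `g` is square integrable on the cube and is the weak mixed derivative `∂^{|u|} f / ∂x_u`
of `f` there, tested against smooth functions with compact support in the open cube. -/
def IsWeakMixedDeriv {d : ℕ} (u : Finset (Fin d)) (f g : (Fin d → ℝ) → ℝ) : Prop :=
  MemLp g 2 (volume.restrict (unitCube d)) ∧
    ∀ φ : (Fin d → ℝ) → ℝ, ContDiff ℝ (⊤ : ℕ∞) φ → HasCompactSupport φ →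
      tsupport φ ⊆ openCube d →
        ∫ x in unitCube d, f x * mixedPartial u φ x
          = (-1) ^ u.card * ∫ x in unitCube d, g x * φ x

open Classical in
/-- The weak mixed derivative of `f` (unique almost everywhere on the cube when it exists). -/
def weakMixedDeriv {d : ℕ} (u : Finset (Fin d)) (f : (Fin d → ℝ) → ℝ) : (Fin d → ℝ) → ℝ :=
  if h : ∃ g, IsWeakMixedDeriv u f g then h.choose else 0

/-- `∫_{[0,1)^{d-|u|}} g(x_u, y_{-u}) dy_{-u}`, as a function of `x` through `x_u` only.
The integral runs over all of `y`; the coordinates `y_u` do not enter and have total mass one. -/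
def partialMean {d : ℕ} (u : Finset (Fin d)) (g : (Fin d → ℝ) → ℝ) (x : Fin d → ℝ) : ℝ :=
  ∫ y in unitCube d, g (fun j => if j ∈ u then x j else y j)

/-- The weights `γ_u` of the sets of coordinates `u ⊆ {0, …, d - 1}`. -/
def weight (γ : Finset ℕ → ℝ) {d : ℕ} (u : Finset (Fin d)) : ℝ := γ (u.map Fin.valEmbedding)

/-- Membership in the weighted unanchored Sobolev space `H_{d,γ}`: `f` is continuous on
`[0,1)^d`, all its mixed derivatives of order at most one in each variable are in `L²`, and
`∫ ∂^{|u|} f / ∂x_u dx_{-u}` vanishes for every `u` with `γ_u = 0`. -/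
structure MemSobolev (γ : Finset ℕ → ℝ) {d : ℕ} (f : (Fin d → ℝ) → ℝ) : Prop where
  continuousOn : ContinuousOn f (unitCube d)
  exists_weakDeriv : ∀ u : Finset (Fin d), ∃ g, IsWeakMixedDeriv u f g
  zero_weight : ∀ u : Finset (Fin d), weight γ u = 0 →
    ∀ᵐ x ∂(volume.restrict (unitCube d)), partialMean u (weakMixedDeriv u f) x = 0

/-- The norm of `H_{d,γ}`:
`‖f‖² = ∑_u γ_u⁻¹ ∫_{[0,1)^{|u|}} (∫_{[0,1)^{d-|u|}} ∂^{|u|} f / ∂x_u dx_{-u})² dx_u`.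
The terms with `γ_u = 0` are zero (`0⁻¹ = 0`), which on `H_{d,γ}` is the convention `0/0 = 0`. -/
def sobolevNorm (γ : Finset ℕ → ℝ) {d : ℕ} (f : (Fin d → ℝ) → ℝ) : ℝ :=
  √(∑ u : Finset (Fin d),
    (weight γ u)⁻¹ * ∫ x in unitCube d, (partialMean u (weakMixedDeriv u f) x) ^ 2)

/-- The node `x_i = ({i z_1 / n}, …, {i z_d / n})` of the lattice rule. -/
def latticePoint {d : ℕ} (n : ℕ) (z : Fin d → ℕ) (i : ℕ) : Fin d → ℝ :=
  fun j => Int.fract ((i : ℝ) * (z j : ℝ) / (n : ℝ))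

/-- The unshifted rank-1 lattice rule `Q_{d,n,z}`. -/
def latticeRule {d : ℕ} (n : ℕ) (z : Fin d → ℕ) (f : (Fin d → ℝ) → ℝ) : ℝ :=
  (1 / (n : ℝ)) * ∑ i ∈ Finset.range n, f (latticePoint n z i)

/-- The worst-case error `e(n, z)` in `H_{d,γ}`, a supremum in `[0, ∞]`. -/
def worstCaseError (γ : Finset ℕ → ℝ) {d : ℕ} (n : ℕ) (z : Fin d → ℕ) : ℝ≥0∞ :=
  ⨆ f : {f : (Fin d → ℝ) → ℝ // MemSobolev γ f ∧ sobolevNorm γ f ≤ 1},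
    ENNReal.ofReal |(∫ x in unitCube d, f.1 x) - latticeRule n z f.1|

/-- The generating vectors `{1, …, n - 1}^d`. -/
def generatingVectors (d n : ℕ) : Finset (Fin d → ℕ) :=
  Fintype.piFinset fun _ => Finset.Icc 1 (n - 1)

/-- The mean over all generating vectors of the squared worst-case error. -/
def meanSqError (γ : Finset ℕ → ℝ) (d n : ℕ) : ℝ≥0∞ :=
  (((n - 1 : ℕ) : ℝ≥0∞) ^ d)⁻¹ * ∑ z ∈ generatingVectors d n, worstCaseError γ n z ^ 2

/-- The constant `C_u`, which depends on `u` only through `k = |u|`. -/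
def boundConst (k : ℕ) : ℝ :=
  2 / 3 ^ k + 1 / 4 ^ k + 4 * (23 / 24) ^ k + (3 / Real.pi ^ 2 + 5 / 6) ^ k

/-- `∑_{∅ ≠ u ⊆ {0, …, d - 1}} γ_u C_u`. -/
def weightedSum (γ : Finset ℕ → ℝ) (d : ℕ) : ℝ :=
  ∑ u ∈ (Finset.range d).powerset with u.Nonempty, γ u * boundConst u.card

end LatticeQMC

end

/-!
In one variable, integration by parts gives `f x = ∫ f + ∫ f' t * k x t dt` with the kernel
`k x t = t - 1_{x < t}` (`jumpKernel`). Tensorized, this writes a function of the Sobolev space at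
every point of the cube as a sum over `u` of integrals of its mixed derivatives against products
of `k` (`eq_sum_integral_weakDeriv`). Only weak derivatives are available, so the formula is
obtained as a limit: for unit bumps `φ j` near `x j` and a unit bump `η` close to `1`, expanding
`∏ φ j = ∏ ((φ j - η) + η)` and using that `φ j - η` has mean zero, hence is minus the derivative
of a test function, gives an exact identity; dominated convergence then yields the formula.
The `u`-term only sees the partial mean of the derivative, so Cauchy-Schwarz bounds the squared
error of an equal-weight rule by `∑ γ_u * kernelMean` over nonempty `u`
(`abs_integral_sub_rule_le`), where `kernelMean` averages over pairs of nodes the products of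
`∫ k x t * k y t dt = B₂({x - y}) / 2 + (x - 1 / 2) (y - 1 / 2)` (`integral_jumpKernel_mul`).

For the lattice rule, the mean over all `z` of such a product is a power of the one-dimensional
mean `meanKernel n i k` over nonzero residues. That mean is at most `1 / 3` in absolute value, so
all its powers are controlled by its first absolute moment. The Bernoulli part sums explicitly,
and the rest is the correlation `∑ z, saw (i z) saw (k z)` of two dilated sawtooths,
essentially a Dedekind sum. In Fourier coefficients it is a sum over the frequencies with `l i + m k = 0`, so that
summing its absolute value over `i` and `k` costs only `(∑ |F l|) ^ 2 = O(p ^ 2 log ^ 2 p)`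
(`sum_abs_correlation_zmodSaw_le`). The resulting first moment `O(log ^ 2 n / n)` is below
`log n / √n` times the required constant for every odd prime `n`.

The number `C_u` is a sum of geometric terms in `|u|`, and `∑_u ∏_{j ∈ u} c γ_j` converges
exactly when `∑ γ_j` does, which is the criterion for product weights.
-/

open Filter Topology

/-! ### Fourier coefficients of the sawtooth modulo `p` -/

/-- The sawtooth `x ↦ {x / p} - 1 / 2` on `ℤ / pℤ`. Unlike the classical `((x / p))`, it takes
the value `-1 / 2`, not `0`, at `x = 0`. -/
noncomputable def zmodSaw (p : ℕ) (x : ZMod p) : ℝ := (x.val : ℝ) / p - 1 / 2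

/-- The values `B₂({x / p}) / 2` of the halved second Bernoulli polynomial. -/
noncomputable def zmodBernoulliTwo (p : ℕ) (x : ZMod p) : ℝ :=
  1 / 2 * (((x.val : ℝ) / p) ^ 2 - (x.val : ℝ) / p + 1 / 6)

section
variable {p : ℕ} [NeZero p]

lemma sum_zmod_val {M : Type*} [AddCommMonoid M] (f : ℕ → M) :
    ∑ x : ZMod p, f x.val = ∑ i ∈ Finset.range p, f i := by
  refine Finset.sum_bij (fun x _ => x.val) (fun x _ => Finset.mem_range.2 x.val_lt)
    (fun x _ y _ h => ZMod.val_injective p h) (fun i hi => ⟨i, Finset.mem_univ _, ?_⟩)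
    (fun _ _ => rfl)
  exact ZMod.val_natCast_of_lt (Finset.mem_range.1 hi)

lemma sum_range_cast (n : ℕ) : ∑ i ∈ Finset.range n, (i : ℝ) = n * (n - 1) / 2 := by
  induction n with
  | zero => simp
  | succ n ih => rw [Finset.sum_range_succ, ih]; push_cast; ring

lemma sum_range_sq_cast (n : ℕ) :
    ∑ i ∈ Finset.range n, (i : ℝ) ^ 2 = n * (n - 1) * (2 * n - 1) / 6 := by
  induction n with
  | zero => simp
  | succ n ih => rw [Finset.sum_range_succ, ih]; push_cast; ring

lemma sum_zmodSaw : ∑ x : ZMod p, zmodSaw p x = -1 / 2 := by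
  have hp : (p : ℝ) ≠ 0 := NeZero.ne _
  unfold zmodSaw
  rw [sum_zmod_val (fun i => (i : ℝ) / p - 1 / 2), Finset.sum_sub_distrib, ← Finset.sum_div,
    sum_range_cast]
  simp
  field_simp
  ring

lemma sum_zmodBernoulliTwo : ∑ x : ZMod p, zmodBernoulliTwo p x = 1 / (12 * p) := by
  have hp : (p : ℝ) ≠ 0 := NeZero.ne _
  unfold zmodBernoulliTwo
  rw [sum_zmod_val (fun i => 1 / 2 * (((i : ℝ) / p) ^ 2 - (i : ℝ) / p + 1 / 6)),
    ← Finset.mul_sum, Finset.sum_add_distrib, Finset.sum_sub_distrib, ← Finset.sum_div,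
    sum_range_cast]
  simp only [div_pow]
  rw [← Finset.sum_div, sum_range_sq_cast]
  simp
  field_simp
  ring

lemma zmodSaw_add_one (x : ZMod p) :
    zmodSaw p (x + 1) = zmodSaw p x + 1 / p - if x = -1 then 1 else 0 := by
  have hp : (p : ℝ) ≠ 0 := NeZero.ne _
  unfold zmodSaw
  have hx := x.val_lt
  split_ifs with h
  · subst h
    obtain ⟨q, rfl⟩ := Nat.exists_eq_succ_of_ne_zero (NeZero.ne p)
    simp [ZMod.val_neg_one]
    push_cast at hp
    field_simp
    ring
  · have : (x + 1).val = x.val + 1 := by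
      have h1 : x.val + 1 < p := by
        refine lt_of_le_of_ne hx fun h2 => h ?_
        have : ((x.val + 1 : ℕ) : ZMod p) = 0 := by rw [h2]; simp
        push_cast at this
        rw [ZMod.natCast_zmod_val] at this
        exact eq_neg_of_add_eq_zero_left this
      have := ZMod.val_natCast_of_lt h1
      push_cast at this
      rwa [ZMod.natCast_zmod_val] at this
    rw [this]; push_cast; ring

/-- The discrete Fourier transform of the sawtooth, evaluated by summation by parts. -/
lemma norm_dft_zmodSaw {l : ZMod p} (hl : l ≠ 0) :
    ‖ZMod.dft (fun x => (zmodSaw p x : ℂ)) l‖ = 1 / ‖ZMod.stdAddChar l - 1‖ := by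
  set e := ZMod.stdAddChar (N := p) with he
  set F := ZMod.dft (fun x => (zmodSaw p x : ℂ)) l with hF
  have hne : e l - 1 ≠ 0 := by
    rw [sub_ne_zero, ← e.map_zero_eq_one]
    exact fun h => hl (ZMod.injective_stdAddChar h)
  have hsum : ∑ x : ZMod p, e (-(x * l)) = 0 := by
    have := AddChar.sum_mulShift (R := ZMod p) (ψ := e) (-l) (ZMod.isPrimitive_stdAddChar p)
    simp only [neg_eq_zero, hl, if_false] at this
    rw [← Nat.cast_zero, ← this]
    simp
  have h1 : F = ∑ x : ZMod p, e (-(x * l)) * (zmodSaw p x : ℂ) := by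
    rw [hF, ZMod.dft_apply]; simp [he]
  have h2 : e l * F = ∑ x : ZMod p, e (-(x * l)) * (zmodSaw p (x + 1) : ℂ) := by
    rw [h1, ← Equiv.sum_comp (Equiv.addRight (1 : ZMod p)), Finset.mul_sum]
    refine Finset.sum_congr rfl fun x _ => ?_
    rw [← mul_assoc, ← AddChar.map_add_eq_mul]
    simp only [Equiv.coe_addRight]
    congr 2
    ring_nf
  have h3 : (e l - 1) * F = - e l := by
    rw [sub_mul, one_mul, h2]
    simp only [zmodSaw_add_one]
    rw [h1, ← Finset.sum_sub_distrib]
    have : ∀ x : ZMod p, e (-(x * l)) * ((zmodSaw p x + 1 / p - if x = -1 then 1 else 0 : ℝ) : ℂ) -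
        e (-(x * l)) * (zmodSaw p x : ℂ) = e (-(x * l)) * (1 / p) -
          if x = -1 then e (-(x * l)) else 0 := by
      intro x
      split_ifs <;> push_cast <;> ring
    rw [Finset.sum_congr rfl fun x _ => this x, Finset.sum_sub_distrib, ← Finset.sum_mul, hsum]
    simp
  have h4 : ‖e l - 1‖ * ‖F‖ = 1 := by
    rw [← norm_mul, h3, norm_neg, he, ZMod.stdAddChar_apply, Circle.norm_coe]
  rw [eq_div_iff (norm_ne_zero_iff.2 hne), mul_comm, h4]

lemma norm_dft_zmodSaw_zero : ‖ZMod.dft (fun x => (zmodSaw p x : ℂ)) 0‖ = 1 / 2 := by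
  rw [ZMod.dft_apply_zero, ← Complex.ofReal_sum, sum_zmodSaw, Complex.norm_real]
  norm_num

lemma norm_stdAddChar_sub_one (l : ZMod p) :
    ‖ZMod.stdAddChar l - 1‖ = 2 * Real.sin (Real.pi * ((l.val : ℝ) / p)) := by
  have hp : (0 : ℝ) < p := by exact_mod_cast Nat.pos_of_ne_zero (NeZero.ne p)
  have h1 : ZMod.stdAddChar l =
      Complex.exp (Complex.I * ((2 * Real.pi * ((l.val : ℝ) / p) : ℝ) : ℂ)) := by
    have := ZMod.stdAddChar_coe (N := p) (l.val : ℤ)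
    simp only [Int.cast_natCast, ZMod.natCast_zmod_val] at this
    rw [this]
    congr 1
    push_cast
    ring
  rw [h1, Complex.norm_exp_I_mul_ofReal_sub_one, Real.norm_eq_abs, abs_of_nonneg]
  · congr 2; ring
  · have h2 : (l.val : ℝ) / p ≤ 1 := by
      rw [div_le_one hp]; exact_mod_cast l.val_lt.le
    have h3 : 0 ≤ (l.val : ℝ) / p := by positivity
    refine mul_nonneg two_pos.le (Real.sin_nonneg_of_nonneg_of_le_pi (by positivity) ?_)
    nlinarith [Real.pi_pos]

lemma one_div_two_mul_sin_le {x : ℝ} (h0 : 0 < x) (h1 : x < 1) :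
    1 / (2 * Real.sin (Real.pi * x)) ≤ 1 / 4 * (1 / x + 1 / (1 - x)) := by
  have key : ∀ y : ℝ, 0 < y → y ≤ 1 / 2 → 2 * y ≤ Real.sin (Real.pi * y) := by
    intro y hy hy'
    have := Real.mul_le_sin (x := Real.pi * y) (by positivity) (by nlinarith [Real.pi_pos])
    refine le_trans (le_of_eq ?_) this
    field_simp
  have h1' : 0 < 1 - x := by linarith
  rcases le_total x (1 / 2) with h | h
  · calc 1 / (2 * Real.sin (Real.pi * x)) ≤ 1 / (2 * (2 * x)) :=
          one_div_le_one_div_of_le (by positivity) (by linarith [key x h0 h])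
      _ = 1 / 4 * (1 / x) := by field_simp; norm_num
      _ ≤ _ := by have : 0 < 1 / (1 - x) := by positivity
                  linarith
  · have h2 := key (1 - x) h1' (by linarith)
    rw [show Real.pi * (1 - x) = Real.pi - Real.pi * x by ring, Real.sin_pi_sub] at h2
    calc 1 / (2 * Real.sin (Real.pi * x)) ≤ 1 / (2 * (2 * (1 - x))) :=
          one_div_le_one_div_of_le (by positivity) (by linarith)
      _ = 1 / 4 * (1 / (1 - x)) := by field_simp; norm_num
      _ ≤ _ := by have : 0 < 1 / x := by positivity
                  linarith

/-- The Fourier coefficients of the sawtooth are summable up to a logarithm. -/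
lemma sum_norm_dft_zmodSaw_le :
    ∑ l : ZMod p, ‖ZMod.dft (fun x => (zmodSaw p x : ℂ)) l‖
      ≤ 1 / 2 + p / 2 * (1 + Real.log p) := by
  have hp : (0 : ℝ) < p := by exact_mod_cast Nat.pos_of_ne_zero (NeZero.ne p)
  rw [← Finset.add_sum_erase _ _ (Finset.mem_univ (0 : ZMod p)), norm_dft_zmodSaw_zero]
  gcongr
  have hle : ∑ l ∈ Finset.univ.erase (0 : ZMod p), ‖ZMod.dft (fun x => (zmodSaw p x : ℂ)) l‖ ≤
      ∑ l : ZMod p, (if l.val = 0 then 0 else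
        (p : ℝ) / 4 * (1 / (l.val : ℝ) + 1 / (p - l.val : ℝ))) := by
    rw [← Finset.add_sum_erase _ _ (Finset.mem_univ (0 : ZMod p))]
    simp only [ZMod.val_zero, if_true, zero_add]
    refine Finset.sum_le_sum fun l hl => ?_
    have hl0 : l ≠ 0 := Finset.ne_of_mem_erase hl
    have hv : l.val ≠ 0 := fun h => hl0 ((ZMod.val_eq_zero l).1 h)
    have hv' : (0 : ℝ) < l.val := by exact_mod_cast Nat.pos_of_ne_zero hv
    have hlt : (l.val : ℝ) < p := by exact_mod_cast l.val_lt
    have hs : (0 : ℝ) < p - l.val := by linarith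
    rw [if_neg hv, norm_dft_zmodSaw hl0, norm_stdAddChar_sub_one]
    refine (one_div_two_mul_sin_le (div_pos hv' hp) ((div_lt_one hp).2 hlt)).trans
      (le_of_eq ?_)
    have : (1 : ℝ) - l.val / p = (p - l.val) / p := by field_simp
    rw [this]
    field_simp
  refine hle.trans ?_
  rw [sum_zmod_val (fun i => if i = 0 then (0 : ℝ) else
        (p : ℝ) / 4 * (1 / (i : ℝ) + 1 / (p - i : ℝ)))]
  obtain ⟨q, hq⟩ := Nat.exists_eq_succ_of_ne_zero (NeZero.ne p)
  have hH : ∑ i ∈ Finset.range q, (1 : ℝ) / (i + 1) ≤ 1 + Real.log p := by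
    have h1 := harmonic_le_one_add_log q
    have h2 : ((harmonic q : ℚ) : ℝ) = ∑ i ∈ Finset.range q, (1 : ℝ) / (i + 1) := by
      simp [harmonic]
    have h3 : Real.log q ≤ Real.log p := by
      rcases Nat.eq_zero_or_pos q with h | h
      · subst h; simp [hq]
      · exact Real.log_le_log (by exact_mod_cast h) (by rw [hq]; push_cast; linarith)
    linarith
  rw [hq, Finset.sum_range_succ']
  simp only [Nat.add_eq_zero_iff, one_ne_zero, and_false, if_false, if_true, add_zero]
  rw [← Finset.mul_sum, Finset.sum_add_distrib]
  have hrefl : ∑ i ∈ Finset.range q, (1 : ℝ) / ((q.succ : ℕ) - (i + 1 : ℕ) : ℝ) =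
      ∑ i ∈ Finset.range q, (1 : ℝ) / (i + 1) := by
    rw [← Finset.sum_range_reflect]
    refine Finset.sum_congr rfl fun i hi => ?_
    have : i < q := Finset.mem_range.1 hi
    have h4 : ((q - 1 - i : ℕ) : ℝ) = q - 1 - i := by
      rw [Nat.cast_sub (by omega), Nat.cast_sub (by omega)]; simp
    congr 1
    push_cast
    rw [h4]; ring
  rw [hrefl]
  push_cast
  rw [hq] at hH
  push_cast at hH
  have : (0 : ℝ) ≤ (q + 1) / 4 := by positivity
  nlinarith

/-- Summed over all dilations `i` and `k`, the sawtooth correlations are of order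
`p ^ 2 log ^ 2 p`: only the frequencies `(l, m)` with `l i + m k = 0` contribute. -/
lemma sum_abs_correlation_zmodSaw_le [Fact p.Prime] :
    ∑ i : ZMod p, ∑ k : ZMod p, |∑ z : ZMod p, zmodSaw p (i * z) * zmodSaw p (k * z)|
      ≤ (1 / 2 + p / 2 * (1 + Real.log p)) ^ 2 + p / 4 := by
  have hp : (0 : ℝ) < p := by exact_mod_cast Nat.pos_of_ne_zero (NeZero.ne p)
  have hpC : (p : ℂ) ≠ 0 := NeZero.ne _
  set e := ZMod.stdAddChar (N := p) with he
  set F := ZMod.dft (fun x => (zmodSaw p x : ℂ)) with hF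
  have hinv : ∀ x, (zmodSaw p x : ℂ) = (p : ℂ)⁻¹ * ∑ l, F l * e (l * x) := by
    intro x
    have h := ZMod.invDFT_apply F x
    rw [hF, LinearEquiv.symm_apply_apply] at h
    rw [h, smul_eq_mul]
    simp [he, hF, mul_comm]
  have hcorr : ∀ i k : ZMod p, ((∑ z : ZMod p, zmodSaw p (i * z) * zmodSaw p (k * z) : ℝ) : ℂ)
      = (p : ℂ)⁻¹ * ∑ l, ∑ m, if l * i + m * k = 0 then F l * F m else 0 := by
    intro i k
    push_cast
    have h1 : ∀ z, (zmodSaw p (i * z) : ℂ) * (zmodSaw p (k * z) : ℂ) =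
        (p : ℂ)⁻¹ * (p : ℂ)⁻¹ * ∑ l, ∑ m, F l * F m * e (z * (l * i + m * k)) := by
      intro z
      rw [hinv, hinv, mul_mul_mul_comm, Finset.sum_mul_sum]
      congr 1
      refine Finset.sum_congr rfl fun l _ => Finset.sum_congr rfl fun m _ => ?_
      rw [mul_mul_mul_comm, ← AddChar.map_add_eq_mul]
      congr 2
      ring
    rw [Finset.sum_congr rfl fun z _ => h1 z, ← Finset.mul_sum, Finset.sum_comm, mul_assoc]
    congr 1
    rw [Finset.mul_sum]
    refine Finset.sum_congr rfl fun l _ => ?_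
    rw [Finset.sum_comm, Finset.mul_sum]
    refine Finset.sum_congr rfl fun m _ => ?_
    rw [← Finset.mul_sum, AddChar.sum_mulShift _ (ZMod.isPrimitive_stdAddChar p)]
    split_ifs
    · rw [ZMod.card]; field_simp
    · simp
  -- Each frequency pair other than `(0, 0)` is met by exactly `p` pairs `(i, k)`.
  have hcount : ∀ l m : ZMod p, ((∑ i : ZMod p, ∑ k : ZMod p,
      if l * i + m * k = 0 then (1 : ℝ) else 0) : ℝ) ≤
        p + if l = 0 ∧ m = 0 then (p : ℝ) ^ 2 else 0 := by
    intro l m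
    by_cases hm : m = 0
    · subst hm
      by_cases hl : l = 0
      · subst hl
        simp [ZMod.card]
        nlinarith
      · simp [hl, ZMod.card]
    · have : ∀ i : ZMod p, (∑ k : ZMod p, if l * i + m * k = 0 then (1 : ℝ) else 0) = 1 := by
        intro i
        have h2 : ∀ k : ZMod p, l * i + m * k = 0 ↔ k = -(l * i) / m := by
          intro k
          rw [eq_div_iff hm]
          constructor
          · intro h; linear_combination h
          · intro h; linear_combination h
        simp [h2]
      simp [this, hm, ZMod.card]
  have hbound : ∀ i k : ZMod p, |∑ z : ZMod p, zmodSaw p (i * z) * zmodSaw p (k * z)| ≤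
      (p : ℝ)⁻¹ * ∑ l, ∑ m, ‖F l‖ * ‖F m‖ * if l * i + m * k = 0 then 1 else 0 := by
    intro i k
    rw [← Real.norm_eq_abs, ← Complex.norm_real, hcorr, norm_mul, norm_inv, Complex.norm_natCast]
    gcongr
    refine (norm_sum_le _ _).trans (Finset.sum_le_sum fun l _ => (norm_sum_le _ _).trans
      (Finset.sum_le_sum fun m _ => ?_))
    split_ifs <;> simp
  calc _ ≤ ∑ i : ZMod p, ∑ k : ZMod p, (p : ℝ)⁻¹ * ∑ l, ∑ m,
        ‖F l‖ * ‖F m‖ * (if l * i + m * k = 0 then 1 else 0) :=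
        Finset.sum_le_sum fun i _ => Finset.sum_le_sum fun k _ => hbound i k
    _ = (p : ℝ)⁻¹ * ∑ l, ∑ m, ‖F l‖ * ‖F m‖ *
        ∑ i : ZMod p, ∑ k : ZMod p, (if l * i + m * k = 0 then (1 : ℝ) else 0) := by
        simp only [Finset.mul_sum]
        refine (Finset.sum_congr rfl fun i _ => Finset.sum_comm).trans (Finset.sum_comm.trans ?_)
        exact Finset.sum_congr rfl fun l _ =>
          (Finset.sum_congr rfl fun i _ => Finset.sum_comm).trans Finset.sum_comm
    _ ≤ (p : ℝ)⁻¹ * ∑ l, ∑ m, ‖F l‖ * ‖F m‖ *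
        (p + if l = 0 ∧ m = 0 then (p : ℝ) ^ 2 else 0) := by
        gcongr with l _ m _
        exact hcount l m
    _ = (∑ l, ‖F l‖) ^ 2 + p * ‖F 0‖ ^ 2 := by
        have h3 : ∀ l m, ‖F l‖ * ‖F m‖ * ((p : ℝ) + if l = 0 ∧ m = 0 then (p : ℝ) ^ 2 else 0) =
            ‖F l‖ * ‖F m‖ * p +
              if l = 0 then (if m = 0 then ‖F 0‖ * ‖F 0‖ * (p : ℝ) ^ 2 else 0) else 0 := by
          intro l m
          by_cases hl : l = 0 <;> by_cases hm : m = 0 <;> simp [hl, hm]; ring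
        simp only [h3, Finset.sum_add_distrib]
        rw [pow_two (∑ l, ‖F l‖), Finset.sum_mul_sum]
        simp only [← Finset.sum_mul]
        simp
        field_simp
    _ ≤ _ := by
        rw [hF, norm_dft_zmodSaw_zero]
        have := sum_norm_dft_zmodSaw_le (p := p)
        have h0 : 0 ≤ ∑ l : ZMod p, ‖ZMod.dft (fun x => (zmodSaw p x : ℂ)) l‖ := by positivity
        have := pow_le_pow_left₀ h0 this 2
        linarith
end

/-! ### Power means of the averaged kernel -/

/-- The reproducing kernel of the one-dimensional unanchored Sobolev space on the mean-zero part,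
`B₂({x - y}) / 2 + (x - 1 / 2) (y - 1 / 2)` written without fractional parts. -/
noncomputable def sobolevKernel (x y : ℝ) : ℝ := 1 / 3 + (x ^ 2 + y ^ 2) / 2 - max x y

section
variable {p : ℕ} [NeZero p]

lemma zmodBernoulliTwo_neg (x : ZMod p) : zmodBernoulliTwo p (-x) = zmodBernoulliTwo p x := by
  have hp : (p : ℝ) ≠ 0 := NeZero.ne _
  unfold zmodBernoulliTwo
  rw [ZMod.neg_val]
  split_ifs with h
  · subst h; simp
  · rw [Nat.cast_sub x.val_lt.le]
    field_simp
    ring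

lemma sobolevKernel_val_div (a b : ZMod p) :
    sobolevKernel ((a.val : ℝ) / p) ((b.val : ℝ) / p) =
      zmodBernoulliTwo p (a - b) + zmodSaw p a * zmodSaw p b := by
  have hp : (0 : ℝ) < p := by exact_mod_cast Nat.pos_of_ne_zero (NeZero.ne p)
  have key : ∀ a b : ZMod p, b.val ≤ a.val →
      sobolevKernel ((a.val : ℝ) / p) ((b.val : ℝ) / p) =
      zmodBernoulliTwo p (a - b) + zmodSaw p a * zmodSaw p b := by
    intro a b h
    unfold sobolevKernel zmodBernoulliTwo zmodSaw
    rw [ZMod.val_sub h, max_eq_left (by gcongr), Nat.cast_sub h]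
    ring
  rcases le_total b.val a.val with h | h
  · exact key a b h
  · have := key b a h
    rw [← neg_sub, zmodBernoulliTwo_neg, mul_comm (zmodSaw p a), ← this]
    unfold sobolevKernel
    rw [max_comm]; ring

lemma abs_sobolevKernel_le {x y : ℝ} (hx : 0 ≤ x) (hx1 : x ≤ 1) (hy : 0 ≤ y) (hy1 : y ≤ 1) :
    |sobolevKernel x y| ≤ 1 / 3 := by
  unfold sobolevKernel
  rw [abs_le]
  rcases max_cases x y with ⟨h, h'⟩ | ⟨h, h'⟩ <;> rw [h] <;> constructor <;> nlinarith

variable [Fact p.Prime]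

lemma sum_dilate_zmodBernoulliTwo {c : ZMod p} (hc : c ≠ 0) :
    ∑ z : ZMod p, zmodBernoulliTwo p (c * z) = 1 / (12 * p) := by
  rw [← sum_zmodBernoulliTwo (p := p)]
  exact Equiv.sum_comp (Equiv.mulLeft₀ c hc) (zmodBernoulliTwo p)

/-- The mean of the kernel over the nodes `i` and `k` of all one-dimensional lattice rules. -/
noncomputable def meanKernel (p : ℕ) [NeZero p] (i k : ZMod p) : ℝ :=
  (∑ z ∈ Finset.univ.erase (0 : ZMod p),
    sobolevKernel (((i * z).val : ℝ) / p) (((k * z).val : ℝ) / p)) / (p - 1)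

lemma card_erase_zero : ((Finset.univ.erase (0 : ZMod p)).card : ℝ) = p - 1 := by
  rw [Finset.card_erase_of_mem (Finset.mem_univ _), Finset.card_univ, ZMod.card,
    Nat.cast_sub (NeZero.one_le)]
  simp

lemma abs_meanKernel_le (hp : 2 ≤ p) (i k : ZMod p) : |meanKernel p i k| ≤ 1 / 3 := by
  have hp1 : (0 : ℝ) < p - 1 := by
    have : (2 : ℝ) ≤ p := by exact_mod_cast hp
    linarith
  have hp0 : (0 : ℝ) < p := by linarith
  unfold meanKernel
  rw [abs_div, abs_of_pos hp1, div_le_iff₀ hp1, ← card_erase_zero, mul_comm, ← nsmul_eq_mul]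
  refine (Finset.abs_sum_le_sum_abs _ _).trans (Finset.sum_le_card_nsmul _ _ _ fun z _ => ?_)
  have h : ∀ a : ZMod p, (a.val : ℝ) / p ≤ 1 := fun a => by
    rw [div_le_one hp0]; exact_mod_cast a.val_lt.le
  exact abs_sobolevKernel_le (by positivity) (h _) (by positivity) (h _)

/-- The terms `1 / 12` and `1 / 4` pay for completing the sums over `z ≠ 0` to all residues; the
Bernoulli part is of order `p` on the diagonal only. -/
lemma abs_meanKernel_le_correlation (hp : 2 ≤ p) (i k : ZMod p) :
    |meanKernel p i k| * (p - 1) ≤ (1 / 12 + if i = k then (p : ℝ) / 12 else 0) +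
      |∑ z : ZMod p, zmodSaw p (i * z) * zmodSaw p (k * z)| + 1 / 4 := by
  have hp1 : (0 : ℝ) < p - 1 := by
    have : (2 : ℝ) ≤ p := by exact_mod_cast hp
    linarith
  have hp0 : (0 : ℝ) < p := by linarith
  unfold meanKernel
  rw [abs_div, abs_of_pos hp1, div_mul_cancel₀ _ hp1.ne']
  simp only [sobolevKernel_val_div]
  rw [Finset.sum_add_distrib]
  have h1 := Finset.add_sum_erase Finset.univ
    (fun z => zmodSaw p (i * z) * zmodSaw p (k * z)) (Finset.mem_univ (0 : ZMod p))
  have h2 := Finset.add_sum_erase Finset.univ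
    (fun z => zmodBernoulliTwo p (i * z - k * z)) (Finset.mem_univ (0 : ZMod p))
  have h0 : zmodSaw p 0 = -1 / 2 := by simp [zmodSaw]; norm_num
  have hb0 : zmodBernoulliTwo p 0 = 1 / 12 := by simp [zmodBernoulliTwo]; norm_num
  simp only [mul_zero, sub_zero, h0, hb0] at h1 h2
  have h3 : |∑ z : ZMod p, zmodBernoulliTwo p (i * z - k * z) - 1 / 12| ≤
      1 / 12 + if i = k then (p : ℝ) / 12 else 0 := by
    split_ifs with h
    · subst h
      simp only [sub_self, hb0]
      simp only [Finset.sum_const, Finset.card_univ, ZMod.card, nsmul_eq_mul]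
      rw [abs_le]; constructor <;> linarith
    · have : ∀ z : ZMod p, i * z - k * z = (i - k) * z := fun z => by ring
      simp only [this]
      rw [sum_dilate_zmodBernoulliTwo (sub_ne_zero.2 h)]
      have h5 : 1 / (12 * (p : ℝ)) ≤ 1 / 12 := by
        apply one_div_le_one_div_of_le <;> linarith
      have h6 : 0 < 1 / (12 * (p : ℝ)) := by positivity
      rw [abs_le]; constructor <;> linarith
  have h4 : ∑ z ∈ Finset.univ.erase (0 : ZMod p), zmodBernoulliTwo p (i * z - k * z) =
      ∑ z : ZMod p, zmodBernoulliTwo p (i * z - k * z) - 1 / 12 := by linarith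
  have h5 : ∑ z ∈ Finset.univ.erase (0 : ZMod p), zmodSaw p (i * z) * zmodSaw p (k * z) =
      ∑ z : ZMod p, zmodSaw p (i * z) * zmodSaw p (k * z) - 1 / 4 := by linarith
  rw [h4, h5]
  refine (abs_add_le _ _).trans ?_
  have h7 := abs_sub (∑ z : ZMod p, zmodSaw p (i * z) * zmodSaw p (k * z)) (1 / 4)
  rw [abs_of_pos (by norm_num : (0 : ℝ) < 1 / 4)] at h7
  linarith

lemma log_le_sqrt {x : ℝ} (hx : 0 < x) : Real.log x ≤ √x := by
  have h1 := Real.log_le_sub_one_of_pos (x := √x / Real.exp 1) (by positivity)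
  rw [Real.log_div (by positivity) (by positivity), Real.log_exp, Real.log_sqrt hx.le] at h1
  have h2 : √x / Real.exp 1 ≤ √x / 2 := by
    gcongr
    linarith [Real.exp_one_gt_d9]
  linarith

/-- The first absolute moment is of order `log ^ 2 p / p`; one factor `log p` is traded for `√p`.
The constant `23 / 6 = 4 * 23 / 24` is what `boundConst 1` allows through its third term. -/
lemma sum_abs_meanKernel_le (hp : 3 ≤ p) :
    (∑ i : ZMod p, ∑ k : ZMod p, |meanKernel p i k|) / (p : ℝ) ^ 2
      ≤ 23 / 6 * (Real.log p / √p) := by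
  have hp3 : (3 : ℝ) ≤ p := by exact_mod_cast hp
  have hp1 : (0 : ℝ) < p - 1 := by linarith
  have hp0 : (0 : ℝ) < p := by linarith
  set L := Real.log p with hL
  set s := √(p : ℝ) with hs
  have hs0 : 0 < s := Real.sqrt_pos.2 hp0
  have hss : s * s = p := Real.mul_self_sqrt hp0.le
  have hL1 : 1 ≤ L := by
    rw [hL, Real.le_log_iff_exp_le hp0]
    linarith [Real.exp_one_lt_d9]
  have hLs : L ≤ s := log_le_sqrt hp0
  have h1 : (∑ i : ZMod p, ∑ k : ZMod p, |meanKernel p i k|) * (p - 1) ≤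
      (p : ℝ) ^ 2 / 3 + p ^ 2 / 12 + ((1 / 2 + p / 2 * (1 + L)) ^ 2 + p / 4) := by
    simp only [Finset.sum_mul]
    refine (Finset.sum_le_sum fun i _ => Finset.sum_le_sum fun k _ =>
      abs_meanKernel_le_correlation (by omega) i k).trans ?_
    simp only [Finset.sum_add_distrib]
    have := sum_abs_correlation_zmodSaw_le (p := p)
    simp [ZMod.card] at this ⊢
    nlinarith
  have h2 : (p : ℝ) ^ 2 / 3 + p ^ 2 / 12 + ((1 / 2 + p / 2 * (1 + L)) ^ 2 + p / 4) ≤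
      (23 / 6 * (L / s) * p ^ 2) * (p - 1) := by
    have e1 : L / s * (p : ℝ) ^ 2 = L * s * p := by
      rw [← hss]; field_simp
    have e2 : (23 / 6 * (L / s) * (p : ℝ) ^ 2) = 23 / 6 * (L * s * p) := by rw [← e1]; ring
    rw [e2]
    -- Both `p - 1 ≥ 2 p / 3` and `log p ≥ 1` come from `p ≥ 3`.
    have e3 : 2 / 3 * (p : ℝ) ≤ p - 1 := by linarith
    have e4 : L * L ≤ L * s := by gcongr
    have e5 : 23 / 6 * (L * L * p) * (2 / 3 * p) ≤ 23 / 6 * (L * s * p) * (p - 1) := by gcongr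
    refine le_trans ?_ e5
    have e6 : 1 / 2 + (p : ℝ) / 2 * (1 + L) ≤ 7 / 6 * (p * L) := by nlinarith
    have e7 : (1 / 2 + (p : ℝ) / 2 * (1 + L)) ^ 2 ≤ (7 / 6 * (p * L)) ^ 2 := by
      apply pow_le_pow_left₀ _ e6; positivity
    have e8 : (p : ℝ) ^ 2 ≤ (p * L) ^ 2 := by
      apply pow_le_pow_left₀ hp0.le; nlinarith
    nlinarith
  rw [div_le_iff₀ (by positivity)]
  exact le_of_mul_le_mul_right (h1.trans h2) hp1

lemma boundConst_pos (k : ℕ) : 0 < LatticeQMC.boundConst k := by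
  unfold LatticeQMC.boundConst; positivity

/-- The number-theoretic core: since `|meanKernel| ≤ 1 / 3`, all power means are controlled by the
first absolute moment. -/
lemma sum_meanKernel_pow_le (hp : 3 ≤ p) {s : ℕ} (hs : s ≠ 0) :
    (∑ i : ZMod p, ∑ k : ZMod p, meanKernel p i k ^ s) / (p : ℝ) ^ 2
      ≤ Real.log p / √p * LatticeQMC.boundConst s := by
  obtain ⟨r, rfl⟩ := Nat.exists_eq_succ_of_ne_zero hs
  have hL : 0 ≤ Real.log p / √p :=
    div_nonneg (Real.log_nonneg (by exact_mod_cast (by omega : 1 ≤ p))) (Real.sqrt_nonneg _)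
  have h1 : ∑ i : ZMod p, ∑ k : ZMod p, meanKernel p i k ^ (r + 1) ≤
      (1 / 3) ^ r * ∑ i : ZMod p, ∑ k : ZMod p, |meanKernel p i k| := by
    simp only [Finset.mul_sum]
    refine Finset.sum_le_sum fun i _ => Finset.sum_le_sum fun k _ => ?_
    refine (le_abs_self _).trans ?_
    rw [abs_pow, pow_succ]
    gcongr
    exact abs_meanKernel_le (by omega) i k
  -- Only the term `4 * (23 / 24) ^ |u|` of the constant is needed.
  have h2 : (23 / 6) * (1 / 3 : ℝ) ^ r ≤ LatticeQMC.boundConst (r + 1) := by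
    have h3 : (1 / 3 : ℝ) ^ r ≤ (23 / 24) ^ r := pow_le_pow_left₀ (by norm_num) (by norm_num) r
    have h4 : 4 * (23 / 24 : ℝ) ^ (r + 1) ≤ LatticeQMC.boundConst (r + 1) := by
      unfold LatticeQMC.boundConst
      have : 0 ≤ 2 / (3 : ℝ) ^ (r + 1) + 1 / 4 ^ (r + 1) := by positivity
      have : 0 ≤ (3 / Real.pi ^ 2 + 5 / 6) ^ (r + 1) := by positivity
      linarith
    rw [pow_succ] at h4
    linarith
  calc _ ≤ ((1 / 3) ^ r * ∑ i : ZMod p, ∑ k : ZMod p, |meanKernel p i k|) / (p : ℝ) ^ 2 := by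
        gcongr
    _ = (1 / 3) ^ r * ((∑ i : ZMod p, ∑ k : ZMod p, |meanKernel p i k|) / (p : ℝ) ^ 2) := by ring
    _ ≤ (1 / 3) ^ r * (23 / 6 * (Real.log p / √p)) := by
        gcongr; exact sum_abs_meanKernel_le hp
    _ = Real.log p / √p * (23 / 6 * (1 / 3) ^ r) := by ring
    _ ≤ _ := by gcongr
end

/-! ### Bump functions on the unit interval -/

/-- A nonnegative test function on the open unit interval of total mass one. -/
structure IsUnitBump (g : ℝ → ℝ) : Prop where
  contDiff : ContDiff ℝ (⊤ : ℕ∞) g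
  nonneg : ∀ t, 0 ≤ g t
  tsupport_subset : tsupport g ⊆ Set.Ioo 0 1
  integral_eq_one : ∫ t, g t = 1

/-- The kernel of `f x - ∫ f = ∫ f' t * jumpKernel x t dt` on the unit interval. -/
noncomputable def jumpKernel (x t : ℝ) : ℝ := t - if x < t then 1 else 0

lemma hasCompactSupport_of_tsupport_subset_Ioo {g : ℝ → ℝ} {a b : ℝ}
    (h : tsupport g ⊆ Set.Ioo a b) : HasCompactSupport g :=
  isCompact_Icc.of_isClosed_subset (isClosed_tsupport g) (h.trans Set.Ioo_subset_Icc_self)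

lemma integral_Iic_of_tsupport {g : ℝ → ℝ} {a b t : ℝ} (h : tsupport g ⊆ Set.Ioo a b)
    (ht : b ≤ t) : ∫ s in Set.Iic t, g s = ∫ s, g s := by
  refine setIntegral_eq_integral_of_forall_compl_eq_zero fun s hs => ?_
  refine image_eq_zero_of_notMem_tsupport fun hs' => hs ?_
  exact (h hs').2.le.trans ht

lemma integral_Iic_eq_zero_of_tsupport {g : ℝ → ℝ} {a b t : ℝ} (h : tsupport g ⊆ Set.Ioo a b)
    (ht : t ≤ a) : ∫ s in Set.Iic t, g s = 0 := by
  refine setIntegral_eq_zero_of_forall_eq_zero fun s hs => ?_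
  refine image_eq_zero_of_notMem_tsupport fun hs' => ?_
  exact absurd (h hs').1 (not_lt.2 (le_trans hs ht))

lemma exists_Icc_of_isCompact_subset_Ioo {K : Set ℝ} {a b : ℝ} (hab : a < b) (hK : IsCompact K)
    (h : K ⊆ Set.Ioo a b) : ∃ a' b', a < a' ∧ b' < b ∧ K ⊆ Set.Icc a' b' := by
  rcases K.eq_empty_or_nonempty with rfl | hne
  · exact ⟨(a + b) / 2, (a + b) / 2, by linarith, by linarith, Set.empty_subset _⟩
  · obtain ⟨a', ha', ha''⟩ := hK.exists_isLeast hne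
    obtain ⟨b', hb', hb''⟩ := hK.exists_isGreatest hne
    exact ⟨a', b', (h ha').1, (h hb').2, fun x hx => ⟨ha'' hx, hb'' hx⟩⟩

/-- A mean-zero test function on the unit interval is the derivative of a test function. -/
lemma primitive_isTest {g : ℝ → ℝ} (hg : ContDiff ℝ (⊤ : ℕ∞) g) (hs : tsupport g ⊆ Set.Ioo 0 1)
    (h0 : ∫ t, g t = 0) :
    ContDiff ℝ (⊤ : ℕ∞) (fun t => ∫ s in Set.Iic t, g s) ∧
      tsupport (fun t => ∫ s in Set.Iic t, g s) ⊆ Set.Ioo 0 1 ∧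
      ∀ t, HasDerivAt (fun t => ∫ s in Set.Iic t, g s) (g t) t := by
  have hint : Integrable g := hg.continuous.integrable_of_hasCompactSupport
    (hasCompactSupport_of_tsupport_subset_Ioo hs)
  have hderiv : ∀ t, HasDerivAt (fun t => ∫ s in Set.Iic t, g s) (g t) t := by
    intro t
    have h1 : (fun t => ∫ s in Set.Iic t, g s) =
        fun t => (∫ s in (0 : ℝ)..t, g s) + ∫ s in Set.Iic 0, g s := by
      funext t
      rw [intervalIntegral.integral_Iic_sub_Iic hint.integrableOn hint.integrableOn |>.symm]
      ring
    rw [h1]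
    exact (intervalIntegral.integral_hasDerivAt_right (hint.intervalIntegrable)
      (hg.continuous.stronglyMeasurableAtFilter _ _) hg.continuous.continuousAt).add_const _
  refine ⟨?_, ?_, hderiv⟩
  · refine contDiff_infty_iff_deriv.2 ⟨fun t => (hderiv t).differentiableAt, ?_⟩
    rwa [show deriv (fun t => ∫ s in Set.Iic t, g s) = g from funext fun t => (hderiv t).deriv]
  · obtain ⟨a, b, ha, hb, hab⟩ := exists_Icc_of_isCompact_subset_Ioo zero_lt_one
      (hasCompactSupport_of_tsupport_subset_Ioo hs) hs
    refine (closure_minimal (t := Set.Icc a b) ?_ isClosed_Icc).trans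
      (Set.Icc_subset_Ioo ha hb)
    intro t ht
    by_contra hcon
    refine ht ?_
    rw [Set.mem_Icc, not_and_or, not_le, not_le] at hcon
    rcases hcon with h | h
    · refine setIntegral_eq_zero_of_forall_eq_zero fun s hs => ?_
      exact image_eq_zero_of_notMem_tsupport fun hs' =>
        absurd (hab hs').1 (not_le.2 (lt_of_le_of_lt hs h))
    · dsimp only
      rw [setIntegral_eq_integral_of_forall_compl_eq_zero fun s hs => ?_, h0]
      exact image_eq_zero_of_notMem_tsupport fun hs' => hs ((hab hs').2.trans h.le)

lemma IsUnitBump.hasCompactSupport {g : ℝ → ℝ} (hg : IsUnitBump g) : HasCompactSupport g :=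
  hasCompactSupport_of_tsupport_subset_Ioo hg.tsupport_subset

lemma IsUnitBump.integrable {g : ℝ → ℝ} (hg : IsUnitBump g) : Integrable g :=
  hg.contDiff.continuous.integrable_of_hasCompactSupport hg.hasCompactSupport

lemma IsUnitBump.integral_Iic_mem {g : ℝ → ℝ} (hg : IsUnitBump g) (t : ℝ) :
    ∫ s in Set.Iic t, g s ∈ Set.Icc (0 : ℝ) 1 := by
  refine ⟨setIntegral_nonneg measurableSet_Iic fun s _ => hg.nonneg s, ?_⟩
  rw [← hg.integral_eq_one]
  exact setIntegral_le_integral hg.integrable (Eventually.of_forall hg.nonneg)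

/-- Unit bumps approximating the constant function `1` on the unit interval, boundedly. -/
lemma exists_bump_tendsto_one : ∃ η : ℕ → ℝ → ℝ, (∀ m, IsUnitBump (η m)) ∧
    (∀ m t, η m t ≤ 2) ∧ ∀ t ∈ Set.Ioo (0 : ℝ) 1, Tendsto (fun m => η m t) atTop (𝓝 1) := by
  set δ : ℕ → ℝ := fun m => 1 / ((m : ℝ) + 4) with hδ
  have hδ0 : ∀ m, 0 < δ m := fun m => by simp only [hδ]; positivity
  have hδ4 : ∀ m, δ m ≤ 1 / 4 := fun m => by
    simp only [hδ]; apply one_div_le_one_div_of_le <;> linarith [m.cast_nonneg (α := ℝ)]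
  have hδt : Tendsto δ atTop (𝓝 0) :=
    tendsto_const_nhds.div_atTop (tendsto_natCast_atTop_atTop.atTop_add tendsto_const_nhds)
  let B : ∀ m : ℕ, ContDiffBump (1 / 2 : ℝ) := fun m =>
    ⟨1 / 2 - δ m, 1 / 2 - δ m / 2, by linarith [hδ4 m], by linarith [hδ0 m]⟩
  have hlow : ∀ m, 1 - 2 * δ m ≤ ∫ t, B m t := fun m => by
    have := (B m).measure_closedBall_le_integral volume
    rw [Real.volume_real_closedBall (B m).rIn_pos.le] at this
    change 2 * (1 / 2 - δ m) ≤ _ at this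
    linarith
  have hupp : ∀ m, ∫ t, B m t ≤ 1 := fun m => by
    have := (B m).integral_le_measure_closedBall volume
    rw [Real.volume_real_closedBall (B m).rOut_pos.le] at this
    change _ ≤ 2 * (1 / 2 - δ m / 2) at this
    linarith [hδ0 m]
  refine ⟨fun m => (B m).normed volume, fun m => ⟨(B m).contDiff_normed,
    (B m).nonneg_normed, ?_, (B m).integral_normed⟩, fun m t => ?_, fun t ht => ?_⟩
  · rw [(B m).tsupport_normed_eq, Real.closedBall_eq_Icc]
    change Set.Icc (1 / 2 - (1 / 2 - δ m / 2)) (1 / 2 + (1 / 2 - δ m / 2)) ⊆ _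
    exact Set.Icc_subset_Ioo (by linarith [hδ0 m]) (by linarith [hδ0 m])
  · change (B m).normed volume t ≤ 2
    rw [ContDiffBump.normed_def, div_le_iff₀ (B m).integral_pos]
    have := (B m).le_one (x := t)
    linarith [hlow m, hδ4 m]
  · have hlim : Tendsto (fun m => 1 / ∫ s, B m s) atTop (𝓝 1) := by
      have : Tendsto (fun m => ∫ s, B m s) atTop (𝓝 1) := by
        refine tendsto_of_tendsto_of_tendsto_of_le_of_le ?_ tendsto_const_nhds hlow hupp
        simpa using (hδt.const_mul 2).const_sub 1
      simpa using this.inv₀ one_ne_zero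
    refine hlim.congr' ?_
    have hev : ∀ᶠ m in atTop, δ m < min t (1 - t) :=
      hδt.eventually_lt_const (lt_min ht.1 (by linarith [ht.2]))
    filter_upwards [hev] with m hm
    rw [ContDiffBump.normed_def, (B m).one_of_mem_closedBall]
    rw [Real.closedBall_eq_Icc]
    change t ∈ Set.Icc (1 / 2 - (1 / 2 - δ m)) (1 / 2 + (1 / 2 - δ m))
    have h1 := lt_of_lt_of_le hm (min_le_left _ _)
    have h2 := lt_of_lt_of_le hm (min_le_right _ _)
    constructor <;> linarith

/-- Unit bumps shrinking to the point `x` from the right; the point may be the left end point of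
the interval. -/
lemma exists_bump_tendsto_dirac {x : ℝ} (hx : x ∈ Set.Ico (0 : ℝ) 1) : ∃ φ : ℕ → ℝ → ℝ,
    (∀ m, IsUnitBump (φ m)) ∧ ∀ ε > 0, ∀ᶠ m in atTop, tsupport (φ m) ⊆ Set.Ioo x (x + ε) := by
  set r : ℕ → ℝ := fun m => (1 - x) / ((m : ℝ) + 4) with hr
  have hx1 : 0 < 1 - x := by linarith [hx.2]
  have hr0 : ∀ m, 0 < r m := fun m => by simp only [hr]; positivity
  have hr4 : ∀ m, 4 * r m ≤ 1 - x := fun m => by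
    simp only [hr]
    rw [mul_div_assoc', div_le_iff₀ (by positivity)]
    nlinarith [m.cast_nonneg (α := ℝ)]
  have hrt : Tendsto r atTop (𝓝 0) :=
    tendsto_const_nhds.div_atTop (tendsto_natCast_atTop_atTop.atTop_add tendsto_const_nhds)
  let B : ∀ m : ℕ, ContDiffBump (x + 2 * r m) := fun m =>
    ⟨r m / 2, r m, by linarith [hr0 m], by linarith [hr0 m]⟩
  have hsupp : ∀ m, tsupport ((B m).normed volume) = Set.Icc (x + r m) (x + 3 * r m) := by
    intro m
    rw [(B m).tsupport_normed_eq, Real.closedBall_eq_Icc]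
    change Set.Icc (x + 2 * r m - r m) (x + 2 * r m + r m) = _
    congr 1 <;> ring
  refine ⟨fun m => (B m).normed volume, fun m => ⟨(B m).contDiff_normed,
    (B m).nonneg_normed, ?_, (B m).integral_normed⟩, fun ε hε => ?_⟩
  · rw [hsupp]
    exact Set.Icc_subset_Ioo (by linarith [hr0 m, hx.1]) (by linarith [hr0 m, hr4 m])
  · have hev : ∀ᶠ m in atTop, r m < ε / 3 := hrt.eventually_lt_const (by positivity)
    filter_upwards [hev] with m hm
    rw [hsupp]
    exact Set.Icc_subset_Ioo (by linarith [hr0 m]) (by linarith)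

/-- The primitives of `η - φ` converge boundedly to `jumpKernel x`. -/
lemma tendsto_primitive_jumpKernel {x : ℝ} {η φ : ℕ → ℝ → ℝ}
    (hη : ∀ m, IsUnitBump (η m)) (hη2 : ∀ m t, η m t ≤ 2)
    (hηt : ∀ t ∈ Set.Ioo (0 : ℝ) 1, Tendsto (fun m => η m t) atTop (𝓝 1))
    (hφ : ∀ m, IsUnitBump (φ m))
    (hφt : ∀ ε > 0, ∀ᶠ m in atTop, tsupport (φ m) ⊆ Set.Ioo x (x + ε))
    {t : ℝ} (ht : t ∈ Set.Ioo (0 : ℝ) 1) :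
    Tendsto (fun m => ∫ s in Set.Iic t, (η m s - φ m s)) atTop (𝓝 (jumpKernel x t)) := by
  have h1 : Tendsto (fun m => ∫ s in Set.Iic t, η m s) atTop (𝓝 t) := by
    have h2 : ∀ m, ∫ s in Set.Iic t, η m s = ∫ s in (0 : ℝ)..t, η m s := fun m => by
      rw [← intervalIntegral.integral_Iic_sub_Iic (hη m).integrable.integrableOn
        (hη m).integrable.integrableOn,
        integral_Iic_eq_zero_of_tsupport (hη m).tsupport_subset le_rfl, sub_zero]
    simp only [h2]
    suffices h3 : Tendsto (fun m => ∫ s in (0 : ℝ)..t, η m s) atTop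
        (𝓝 (∫ _ in (0 : ℝ)..t, (1 : ℝ))) by
      rwa [integral_one, sub_zero] at h3
    refine intervalIntegral.tendsto_integral_filter_of_dominated_convergence
      (μ := volume) (fun _ => (2 : ℝ))
      (Eventually.of_forall fun m => (hη m).contDiff.continuous.aestronglyMeasurable)
      (Eventually.of_forall fun m => Eventually.of_forall fun s _ => ?_)
      intervalIntegrable_const
      (Eventually.of_forall fun s hs => ?_)
    · rw [Real.norm_eq_abs, abs_of_nonneg ((hη m).nonneg s)]
      exact hη2 m s
    · rw [Set.uIoc_of_le ht.1.le] at hs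
      exact hηt s ⟨hs.1, hs.2.trans_lt ht.2⟩
  have h4 : Tendsto (fun m => ∫ s in Set.Iic t, φ m s) atTop (𝓝 (if x < t then 1 else 0)) := by
    split_ifs with h
    · refine tendsto_const_nhds.congr' ?_
      filter_upwards [hφt (t - x) (by linarith)] with m hm
      rw [integral_Iic_of_tsupport hm (by linarith), (hφ m).integral_eq_one]
    · refine tendsto_const_nhds.congr' ?_
      filter_upwards [hφt 1 one_pos] with m hm
      rw [integral_Iic_eq_zero_of_tsupport hm (not_lt.1 h)]
  have h5 : ∀ m, ∫ s in Set.Iic t, (η m s - φ m s) =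
      (∫ s in Set.Iic t, η m s) - ∫ s in Set.Iic t, φ m s := fun m =>
    integral_sub (hη m).integrable.integrableOn (hφ m).integrable.integrableOn
  simp only [h5]
  exact h1.sub h4

/-! ### The jump kernel -/

lemma abs_jumpKernel_le_one {x t : ℝ} (ht : t ∈ Set.Ico (0 : ℝ) 1) : |jumpKernel x t| ≤ 1 := by
  unfold jumpKernel
  rw [abs_le]
  split_ifs <;> constructor <;> linarith [ht.1, ht.2]

lemma measurable_jumpKernel (x : ℝ) : Measurable (jumpKernel x) :=
  measurable_id.sub (Measurable.ite measurableSet_Ioi measurable_const measurable_const)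

lemma integral_Ico_ite_lt {a : ℝ} (ha : a ∈ Set.Ico (0 : ℝ) 1) (g : ℝ → ℝ) :
    ∫ t in Set.Ico (0 : ℝ) 1, (if a < t then g t else 0) = ∫ t in a..1, g t := by
  have h1 : (fun t => if a < t then g t else 0) = (Set.Ioi a).indicator g := by
    funext t; simp [Set.indicator_apply]
  rw [h1, setIntegral_indicator measurableSet_Ioi, intervalIntegral.integral_of_le ha.2.le,
    integral_Ioc_eq_integral_Ioo]
  congr 2
  ext t
  simp only [Set.mem_inter_iff, Set.mem_Ico, Set.mem_Ioi, Set.mem_Ioo]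
  constructor
  · rintro ⟨⟨_, h⟩, h'⟩; exact ⟨h', h⟩
  · rintro ⟨h, h'⟩; exact ⟨⟨ha.1.trans h.le, h'⟩, h⟩

/-- The reproducing property of the one-dimensional kernel. -/
lemma integral_jumpKernel_mul {x y : ℝ} (hx : x ∈ Set.Ico (0 : ℝ) 1)
    (hy : y ∈ Set.Ico (0 : ℝ) 1) :
    ∫ t in Set.Ico (0 : ℝ) 1, jumpKernel x t * jumpKernel y t = sobolevKernel x y := by
  have hm : max x y ∈ Set.Ico (0 : ℝ) 1 := ⟨le_max_of_le_left hx.1, max_lt hx.2 hy.2⟩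
  have hexp : ∀ t, jumpKernel x t * jumpKernel y t =
      t ^ 2 - (if x < t then t else 0) - (if y < t then t else 0) +
        (if max x y < t then 1 else 0) := by
    intro t
    unfold jumpKernel
    by_cases h : x < t <;> by_cases h' : y < t <;> simp [h, h'] <;> ring
  have hI : ∀ (g : ℝ → ℝ), Continuous g → IntegrableOn g (Set.Ico 0 1) := fun g hg =>
    (hg.integrableOn_Icc (a := 0) (b := 1)).mono_set Set.Ico_subset_Icc_self
  have hII : ∀ (a : ℝ) (g : ℝ → ℝ), Continuous g →
      IntegrableOn (fun t => if a < t then g t else 0) (Set.Ico 0 1) := fun a g hg => by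
    have : (fun t => if a < t then g t else 0) = (Set.Ioi a).indicator g := by
      funext t; simp [Set.indicator_apply]
    rw [this]
    exact (hI g hg).indicator measurableSet_Ioi
  simp only [hexp]
  have i1 := hI (fun t => t ^ 2) (by fun_prop)
  have i2 := hII x (fun t => t) continuous_id
  have i3 := hII y (fun t => t) continuous_id
  have i4 := hII (max x y) (fun _ => 1) continuous_const
  rw [integral_add (by exact (i1.sub i2).sub i3) i4,
    integral_sub (by exact i1.sub i2) i3, integral_sub i1 i2,
    integral_Ico_ite_lt hx, integral_Ico_ite_lt hy, integral_Ico_ite_lt hm,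
    integral_Ico_eq_integral_Ioo, ← integral_Ioc_eq_integral_Ioo,
    ← intervalIntegral.integral_of_le zero_le_one]
  simp only [integral_pow, integral_id, sobolevKernel]
  simp
  norm_num
  ring

/-! ### The unit cube -/

section
variable {d : ℕ}

lemma measurableSet_unitCube : MeasurableSet (LatticeQMC.unitCube d) :=
  MeasurableSet.univ_pi fun _ => measurableSet_Ico

lemma isOpen_openCube : IsOpen (LatticeQMC.openCube d) :=
  isOpen_set_pi Set.finite_univ fun _ _ => isOpen_Ioo

lemma openCube_subset_unitCube : LatticeQMC.openCube d ⊆ LatticeQMC.unitCube d :=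
  Set.pi_mono fun _ _ => Set.Ioo_subset_Ico_self

lemma openCube_ae_eq_unitCube : LatticeQMC.openCube d =ᵐ[volume] LatticeQMC.unitCube d :=
  (Measure.univ_pi_Ioo_ae_eq_Icc (f := fun _ : Fin d => (0 : ℝ)) (g := fun _ => 1)).trans
    (Measure.univ_pi_Ico_ae_eq_Icc (f := fun _ : Fin d => (0 : ℝ)) (g := fun _ => 1)).symm

lemma restrict_unitCube : volume.restrict (LatticeQMC.unitCube d) =
    Measure.pi fun _ : Fin d => volume.restrict (Set.Ico (0 : ℝ) 1) :=
  Measure.restrict_pi_pi _ _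

instance isProbabilityMeasure_Ico :
    IsProbabilityMeasure (volume.restrict (Set.Ico (0 : ℝ) 1)) :=
  ⟨by simp⟩

instance isProbabilityMeasure_unitCube :
    IsProbabilityMeasure (volume.restrict (LatticeQMC.unitCube d)) := by
  rw [restrict_unitCube]; infer_instance

lemma ae_mem_openCube :
    ∀ᵐ y ∂(volume.restrict (LatticeQMC.unitCube d)), y ∈ LatticeQMC.openCube d := by
  rw [← Measure.restrict_congr_set openCube_ae_eq_unitCube]
  exact ae_restrict_mem isOpen_openCube.measurableSet

/-! ### Tensor product test functions and weak derivatives -/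

lemma contDiff_tensor {θ : Fin d → ℝ → ℝ} (h : ∀ j, ContDiff ℝ (⊤ : ℕ∞) (θ j)) :
    ContDiff ℝ (⊤ : ℕ∞) (fun x : Fin d → ℝ => ∏ j, θ j (x j)) :=
  contDiff_prod fun j _ => (h j).comp (contDiff_apply ℝ ℝ j)

lemma tsupport_tensor_subset {θ : Fin d → ℝ → ℝ} :
    tsupport (fun x : Fin d → ℝ => ∏ j, θ j (x j)) ⊆ Set.univ.pi fun j => tsupport (θ j) := by
  refine closure_minimal (fun x hx j _ => ?_) (isClosed_set_pi fun j _ => isClosed_tsupport _)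
  exact subset_tsupport _ (Finset.prod_ne_zero_iff.1 hx j (Finset.mem_univ j))

lemma hasCompactSupport_tensor {θ : Fin d → ℝ → ℝ} (h : ∀ j, tsupport (θ j) ⊆ Set.Ioo 0 1) :
    HasCompactSupport (fun x : Fin d → ℝ => ∏ j, θ j (x j)) :=
  (isCompact_univ_pi fun j => hasCompactSupport_of_tsupport_subset_Ioo (h j)).of_isClosed_subset
    (isClosed_tsupport _) tsupport_tensor_subset

lemma integrableOn_mul_tensor {f : (Fin d → ℝ) → ℝ}
    (hf : IntegrableOn f (LatticeQMC.unitCube d)) {θ : Fin d → ℝ → ℝ}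
    (h : ∀ j, ContDiff ℝ (⊤ : ℕ∞) (θ j)) (hs : ∀ j, tsupport (θ j) ⊆ Set.Ioo 0 1) :
    IntegrableOn (fun y => f y * ∏ j, θ j (y j)) (LatticeQMC.unitCube d) := by
  have hc := (contDiff_tensor h).continuous
  obtain ⟨C, hC⟩ := hc.bounded_above_of_compact_support (hasCompactSupport_tensor hs)
  exact hf.mul_bdd (c := C) hc.aestronglyMeasurable (Eventually.of_forall hC)

lemma lineDeriv_tensor {θ : Fin d → ℝ → ℝ} (j : Fin d) (h : Differentiable ℝ (θ j))
    (x : Fin d → ℝ) :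
    lineDeriv ℝ (fun x : Fin d → ℝ => ∏ i, θ i (x i)) x (Pi.single j 1) =
      ∏ i, (if i = j then deriv (θ i) else θ i) (x i) := by
  have h1 : (fun t : ℝ => ∏ i, θ i ((x + t • (Pi.single j 1 : Fin d → ℝ)) i)) =
      fun t => θ j (x j + t) * ∏ i ∈ Finset.univ.erase j, θ i (x i) := by
    funext t
    rw [← Finset.mul_prod_erase _ _ (Finset.mem_univ j)]
    congr 1
    · simp
    · refine Finset.prod_congr rfl fun i hi => ?_
      simp [Finset.ne_of_mem_erase hi]
  rw [lineDeriv, h1, ← Finset.mul_prod_erase _ _ (Finset.mem_univ j)]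
  have h2 : HasDerivAt (fun t : ℝ => θ j (x j + t)) (deriv (θ j) (x j)) 0 := by
    have := (h (x j + 0)).hasDerivAt.comp_const_add (x j) 0
    simpa using this
  rw [(h2.mul_const _).deriv, if_pos rfl]
  congr 1
  refine Finset.prod_congr rfl fun i hi => ?_
  rw [if_neg (Finset.ne_of_mem_erase hi)]

lemma foldr_lineDeriv_tensor {θ : Fin d → ℝ → ℝ} (h : ∀ j, Differentiable ℝ (θ j))
    (l : List (Fin d)) (hl : l.Nodup) :
    l.foldr (fun j g x => lineDeriv ℝ g x (Pi.single j 1))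
        (fun x : Fin d → ℝ => ∏ j, θ j (x j)) =
      fun x => ∏ j, (if j ∈ l then deriv (θ j) else θ j) (x j) := by
  induction l with
  | nil => simp
  | cons a l ih =>
    rw [List.nodup_cons] at hl
    rw [List.foldr_cons, ih hl.2]
    funext x
    rw [lineDeriv_tensor a (by rw [if_neg hl.1]; exact h a)]
    refine Finset.prod_congr rfl fun i _ => ?_
    by_cases hia : i = a
    · subst hia; simp [hl.1]
    · simp [hia]

lemma mixedPartial_tensor {θ : Fin d → ℝ → ℝ} (h : ∀ j, Differentiable ℝ (θ j))
    (u : Finset (Fin d)) :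
    LatticeQMC.mixedPartial u (fun x : Fin d → ℝ => ∏ j, θ j (x j)) =
      fun x => ∏ j, (if j ∈ u then deriv (θ j) else θ j) (x j) := by
  unfold LatticeQMC.mixedPartial
  rw [foldr_lineDeriv_tensor h _ (Finset.sort_nodup _ _)]
  simp

/-- Testing the weak derivative against a tensor product, with the primitive of the mean-zero
function `η - φ j` in the variables of `u` and `η` in the others. -/
lemma integral_weakDeriv_mul_tensor {f g : (Fin d → ℝ) → ℝ} {u : Finset (Fin d)}
    (hg : LatticeQMC.IsWeakMixedDeriv u f g) {η : ℝ → ℝ} {φ : Fin d → ℝ → ℝ}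
    (hη : IsUnitBump η) (hφ : ∀ j, IsUnitBump (φ j)) :
    ∫ y in LatticeQMC.unitCube d,
        g y * ∏ j, (if j ∈ u then ∫ s in Set.Iic (y j), (η s - φ j s) else η (y j)) =
      ∫ y in LatticeQMC.unitCube d,
        f y * ∏ j, (if j ∈ u then φ j (y j) - η (y j) else η (y j)) := by
  have hzero : ∀ j, ∫ t, (η t - φ j t) = 0 := fun j => by
    rw [integral_sub hη.integrable (hφ j).integrable, hη.integral_eq_one,
      (hφ j).integral_eq_one, sub_self]
  have hprim : ∀ j, _ := fun j => primitive_isTest (g := fun t => η t - φ j t)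
    (hη.contDiff.sub (hφ j).contDiff)
    ((tsupport_sub _ _).trans (Set.union_subset hη.tsupport_subset (hφ j).tsupport_subset))
    (hzero j)
  set θ : Fin d → ℝ → ℝ := fun j =>
    if j ∈ u then fun t => ∫ s in Set.Iic t, (η s - φ j s) else η with hθ
  have hθc : ∀ j, ContDiff ℝ (⊤ : ℕ∞) (θ j) := fun j => by
    simp only [hθ]; split_ifs
    · exact (hprim j).1
    · exact hη.contDiff
  have hθs : ∀ j, tsupport (θ j) ⊆ Set.Ioo 0 1 := fun j => by
    simp only [hθ]; split_ifs
    · exact (hprim j).2.1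
    · exact hη.tsupport_subset
  have hw := hg.2 (fun x => ∏ j, θ j (x j)) (contDiff_tensor hθc) (hasCompactSupport_tensor hθs)
    (tsupport_tensor_subset.trans (Set.pi_mono fun j _ => hθs j))
  rw [mixedPartial_tensor (fun j => (hθc j).differentiable (by simp))] at hw
  have e1 : ∀ y : Fin d → ℝ, ∏ j, (if j ∈ u then deriv (θ j) else θ j) (y j) =
      (-1) ^ u.card * ∏ j, (if j ∈ u then φ j (y j) - η (y j) else η (y j)) := by
    intro y
    have : ((-1 : ℝ)) ^ u.card = ∏ j, if j ∈ u then (-1 : ℝ) else 1 := by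
      rw [Finset.prod_ite_mem, Finset.univ_inter, Finset.prod_const]
    rw [this, ← Finset.prod_mul_distrib]
    refine Finset.prod_congr rfl fun j _ => ?_
    by_cases hj : j ∈ u
    · simp only [hj, if_true, hθ]
      rw [((hprim j).2.2 (y j)).deriv]
      ring
    · simp [hj, hθ]
  have e2 : ∀ y : Fin d → ℝ, ∏ j, θ j (y j) =
      ∏ j, (if j ∈ u then ∫ s in Set.Iic (y j), (η s - φ j s) else η (y j)) := by
    intro y
    refine Finset.prod_congr rfl fun j _ => ?_
    simp only [hθ]; split_ifs <;> rfl
  simp only [e1, e2] at hw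
  have e3 : ∀ y : Fin d → ℝ, f y *
      ((-1) ^ u.card * ∏ j, (if j ∈ u then φ j (y j) - η (y j) else η (y j))) =
      (-1) ^ u.card * (f y * ∏ j, (if j ∈ u then φ j (y j) - η (y j) else η (y j))) :=
    fun y => by ring
  simp only [e3, integral_const_mul] at hw
  exact (mul_left_cancel₀ (pow_ne_zero _ (by norm_num)) hw).symm

/-- The weak derivative of order zero is the function itself. -/
lemma weakDeriv_empty_ae_eq {f g : (Fin d → ℝ) → ℝ}
    (hf : ContinuousOn f (LatticeQMC.unitCube d)) (hg : LatticeQMC.IsWeakMixedDeriv ∅ f g) :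
    f =ᵐ[volume.restrict (LatticeQMC.unitCube d)] g := by
  have hgi : IntegrableOn g (LatticeQMC.unitCube d) := hg.1.integrable (by norm_num)
  have hfl : LocallyIntegrableOn f (LatticeQMC.openCube d) :=
    (hf.mono openCube_subset_unitCube).locallyIntegrableOn isOpen_openCube.measurableSet
  have hloc : LocallyIntegrableOn (fun x => f x - g x) (LatticeQMC.openCube d) :=
    hfl.sub (hgi.mono_set openCube_subset_unitCube).locallyIntegrableOn
  have key := isOpen_openCube.ae_eq_zero_of_integral_contDiff_smul_eq_zero hloc
    (fun φ hφ hc hs => ?_)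
  · rw [← Measure.restrict_congr_set openCube_ae_eq_unitCube]
    rw [EventuallyEq, ae_restrict_iff' isOpen_openCube.measurableSet]
    filter_upwards [key] with x hx hxU
    linarith [hx hxU]
  · have h1 := hg.2 φ hφ hc hs
    simp only [LatticeQMC.mixedPartial, Finset.sort_empty, List.foldr_nil, Finset.card_empty,
      pow_zero, one_mul] at h1
    have hsupp : ∀ x, x ∉ LatticeQMC.unitCube d → φ x = 0 := fun x hx =>
      image_eq_zero_of_notMem_tsupport fun h => hx (openCube_subset_unitCube (hs h))
    have hfint : IntegrableOn (fun x => f x * φ x) (LatticeQMC.unitCube d) := by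
      have h2 : IntegrableOn (fun x => f x * φ x) (tsupport φ) :=
        ((hf.mono (hs.trans openCube_subset_unitCube)).mul
          hφ.continuous.continuousOn).integrableOn_compact hc
      refine IntegrableOn.of_forall_sdiff_eq_zero h2 measurableSet_unitCube fun x hx => ?_
      rw [image_eq_zero_of_notMem_tsupport hx.2, mul_zero]
    obtain ⟨C, hC⟩ := hφ.continuous.bounded_above_of_compact_support hc
    have hgint : IntegrableOn (fun x => g x * φ x) (LatticeQMC.unitCube d) :=
      hgi.mul_bdd (c := C) hφ.continuous.aestronglyMeasurable (Eventually.of_forall hC)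
    have h3 : ∫ x, φ x • (f x - g x) =
        ∫ x in LatticeQMC.unitCube d, (f x * φ x - g x * φ x) := by
      rw [← setIntegral_eq_integral_of_forall_compl_eq_zero (s := LatticeQMC.unitCube d)
        (fun x hx => by rw [hsupp x hx, zero_smul])]
      refine integral_congr_ae (Eventually.of_forall fun x => ?_)
      simp only [smul_eq_mul]; ring
    rw [h3, integral_sub hfint hgint, h1, sub_self]

/-- Averages of a continuous function against shrinking tensor products of bumps. -/
lemma tendsto_integral_mul_tensor_dirac {f : (Fin d → ℝ) → ℝ}
    (hf : ContinuousOn f (LatticeQMC.unitCube d))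
    (hfi : IntegrableOn f (LatticeQMC.unitCube d)) {x : Fin d → ℝ}
    (hx : x ∈ LatticeQMC.unitCube d) {φ : Fin d → ℕ → ℝ → ℝ}
    (hφ : ∀ j m, IsUnitBump (φ j m))
    (hφt : ∀ j, ∀ ε > 0, ∀ᶠ m in atTop, tsupport (φ j m) ⊆ Set.Ioo (x j) (x j + ε)) :
    Tendsto (fun m => ∫ y in LatticeQMC.unitCube d, f y * ∏ j, φ j m (y j)) atTop (𝓝 (f x)) := by
  have hmass : ∀ m, ∫ y in LatticeQMC.unitCube d, ∏ j, φ j m (y j) = 1 := fun m => by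
    rw [restrict_unitCube, integral_fintype_prod_eq_prod (fun j => φ j m)]
    refine Finset.prod_eq_one fun j _ => ?_
    rw [setIntegral_eq_integral_of_forall_compl_eq_zero, (hφ j m).integral_eq_one]
    exact fun t ht => image_eq_zero_of_notMem_tsupport fun h =>
      ht (Set.Ioo_subset_Ico_self ((hφ j m).tsupport_subset h))
  have hcont : ∀ m, Continuous fun y : Fin d → ℝ => ∏ j, φ j m (y j) := fun m =>
    (contDiff_tensor fun j => (hφ j m).contDiff).continuous
  have hcs : ∀ m, HasCompactSupport fun y : Fin d → ℝ => ∏ j, φ j m (y j) := fun m =>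
    hasCompactSupport_tensor fun j => (hφ j m).tsupport_subset
  rw [Metric.tendsto_atTop']
  intro ε hε
  obtain ⟨δ, hδ, hδf⟩ := Metric.continuousOn_iff.1 hf x hx (ε / 2) (by positivity)
  have hev : ∀ᶠ m in atTop, ∀ j, tsupport (φ j m) ⊆ Set.Ioo (x j) (x j + δ / 2) :=
    eventually_all.2 fun j => hφt j (δ / 2) (by positivity)
  obtain ⟨M, hM⟩ := eventually_atTop.1 hev
  refine ⟨M, fun m hm => ?_⟩
  have hm := hM m hm.le
  have hint : IntegrableOn (fun y => f y * ∏ j, φ j m (y j)) (LatticeQMC.unitCube d) :=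
    integrableOn_mul_tensor hfi (fun j => (hφ j m).contDiff) (fun j => (hφ j m).tsupport_subset)
  have hint1 : IntegrableOn (fun y => ∏ j, φ j m (y j)) (LatticeQMC.unitCube d) :=
    ((hcont m).integrable_of_hasCompactSupport (hcs m)).integrableOn
  have h1 : (∫ y in LatticeQMC.unitCube d, f y * ∏ j, φ j m (y j)) - f x =
      ∫ y in LatticeQMC.unitCube d, (f y - f x) * ∏ j, φ j m (y j) := by
    simp only [sub_mul]
    rw [integral_sub hint (hint1.const_mul _), integral_const_mul, hmass, mul_one]
  rw [Real.dist_eq, h1, ← Real.norm_eq_abs]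
  refine lt_of_le_of_lt ?_ (half_lt_self hε)
  refine (norm_integral_le_of_norm_le (hint1.const_mul (ε / 2)) ?_).trans
    (by rw [integral_const_mul, hmass, mul_one])
  filter_upwards [ae_restrict_mem measurableSet_unitCube] with y hy
  have hnn : 0 ≤ ∏ j, φ j m (y j) := Finset.prod_nonneg fun j _ => (hφ j m).nonneg _
  rw [norm_mul, Real.norm_of_nonneg hnn]
  rcases hnn.eq_or_lt with h0 | h0
  · rw [← h0]; simp
  · refine mul_le_mul_of_nonneg_right ?_ hnn
    have : dist y x < δ := by
      refine lt_of_le_of_lt ((dist_pi_le_iff (by positivity)).2 fun j => ?_) (half_lt_self hδ)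
      have hj := hm j (subset_tsupport _ (Finset.prod_ne_zero_iff.1 h0.ne' j (Finset.mem_univ j)))
      rw [Real.dist_eq, abs_of_nonneg (by linarith [hj.1])]
      linarith [hj.2]
    exact (hδf y hy this).le

lemma prod_eq_sum_prod_ite (a b : Fin d → ℝ) :
    ∏ j, a j = ∑ u : Finset (Fin d), ∏ j, (if j ∈ u then a j - b j else b j) := by
  have h := Fintype.prod_add (fun j => a j - b j) b
  simp only [sub_add_cancel] at h
  rw [h]
  refine Finset.sum_congr rfl fun u _ => ?_
  rw [Finset.prod_ite]
  congr 1
  · exact Finset.prod_congr (by ext; simp) fun _ _ => rfl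
  · exact Finset.prod_congr (by ext; simp) fun _ _ => rfl

lemma continuous_testProduct {η : ℝ → ℝ} {φ : Fin d → ℝ → ℝ}
    (hη : IsUnitBump η) (hφ : ∀ j, IsUnitBump (φ j)) (u : Finset (Fin d)) :
    Continuous fun y : Fin d → ℝ =>
      ∏ j, (if j ∈ u then ∫ s in Set.Iic (y j), (η s - φ j s) else η (y j)) := by
  refine continuous_finsetProd _ fun j _ => ?_
  split_ifs
  · have hz : ∫ t, (η t - φ j t) = 0 := by
      rw [integral_sub hη.integrable (hφ j).integrable, hη.integral_eq_one,
        (hφ j).integral_eq_one, sub_self]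
    have hp := primitive_isTest (g := fun t => η t - φ j t)
      (hη.contDiff.sub (hφ j).contDiff)
      ((tsupport_sub _ _).trans (Set.union_subset hη.tsupport_subset
        (hφ j).tsupport_subset)) hz
    exact hp.1.continuous.comp (continuous_apply j)
  · exact hη.contDiff.continuous.comp (continuous_apply j)

lemma norm_testProduct_le {η : ℝ → ℝ} {φ : Fin d → ℝ → ℝ}
    (hη : IsUnitBump η) (hη2 : ∀ t, η t ≤ 2) (hφ : ∀ j, IsUnitBump (φ j))
    (u : Finset (Fin d)) (y : Fin d → ℝ) :
    ‖∏ j, (if j ∈ u then ∫ s in Set.Iic (y j), (η s - φ j s) else η (y j))‖ ≤ 2 ^ d := by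
  rw [norm_prod]
  refine (Finset.prod_le_prod (g := fun _ => (2 : ℝ)) (fun j _ => norm_nonneg _)
    fun j _ => ?_).trans (by simp)
  rw [Real.norm_eq_abs]
  split_ifs
  · rw [integral_sub hη.integrable.integrableOn (hφ j).integrable.integrableOn, abs_le]
    have a1 := hη.integral_Iic_mem (y j)
    have a2 := (hφ j).integral_Iic_mem (y j)
    constructor <;> linarith [a1.1, a1.2, a2.1, a2.2]
  · rw [abs_of_nonneg (hη.nonneg _)]
    exact hη2 _

/-- The identity behind the representation, before the passage to the limit: it is exact for
every choice of bumps. -/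
lemma integral_mul_tensor_eq_sum {f : (Fin d → ℝ) → ℝ}
    (hfi : IntegrableOn f (LatticeQMC.unitCube d)) {g : Finset (Fin d) → (Fin d → ℝ) → ℝ}
    (hg : ∀ u, LatticeQMC.IsWeakMixedDeriv u f (g u)) {η : ℝ → ℝ} {φ : Fin d → ℝ → ℝ}
    (hη : IsUnitBump η) (hφ : ∀ j, IsUnitBump (φ j)) :
    ∫ y in LatticeQMC.unitCube d, f y * ∏ j, φ j (y j) =
      ∑ u : Finset (Fin d), ∫ y in LatticeQMC.unitCube d, g u y *
        ∏ j, (if j ∈ u then ∫ s in Set.Iic (y j), (η s - φ j s) else η (y j)) := by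
  have hterm : ∀ u : Finset (Fin d), IntegrableOn (fun y => f y *
      ∏ j, (if j ∈ u then φ j (y j) - η (y j) else η (y j)))
        (LatticeQMC.unitCube d) := by
    intro u
    exact integrableOn_mul_tensor hfi (θ := fun j t => if j ∈ u then φ j t - η t else η t)
      (fun j => by
        split_ifs
        · exact (hφ j).contDiff.sub hη.contDiff
        · exact hη.contDiff)
      (fun j => by
        split_ifs
        · exact (tsupport_sub _ _).trans (Set.union_subset (hφ j).tsupport_subset
            hη.tsupport_subset)
        · exact hη.tsupport_subset)
  have hexp : ∀ y : Fin d → ℝ, f y * ∏ j, φ j (y j) =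
      ∑ u : Finset (Fin d), f y * ∏ j, (if j ∈ u then φ j (y j) - η (y j) else η (y j)) :=
    fun y => by
      rw [← Finset.mul_sum]
      exact congrArg _ (prod_eq_sum_prod_ite (fun j => φ j (y j)) (fun j => η (y j)))
  rw [Finset.sum_congr rfl fun u _ => integral_weakDeriv_mul_tensor (hg u) hη hφ, funext hexp]
  exact integral_finsetSum _ fun u _ => hterm u

/-- The representation of a function with square integrable mixed derivatives, valid at every
point of the cube. -/
lemma eq_sum_integral_weakDeriv {f : (Fin d → ℝ) → ℝ}
    (hf : ContinuousOn f (LatticeQMC.unitCube d)) {g : Finset (Fin d) → (Fin d → ℝ) → ℝ}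
    (hg : ∀ u, LatticeQMC.IsWeakMixedDeriv u f (g u)) {x : Fin d → ℝ}
    (hx : x ∈ LatticeQMC.unitCube d) :
    f x = ∑ u : Finset (Fin d), ∫ y in LatticeQMC.unitCube d,
      g u y * ∏ j, (if j ∈ u then jumpKernel (x j) (y j) else 1) := by
  have hgi : ∀ u, IntegrableOn (g u) (LatticeQMC.unitCube d) := fun u =>
    (hg u).1.integrable (by norm_num)
  have hfi : IntegrableOn f (LatticeQMC.unitCube d) :=
    (hgi ∅).congr (weakDeriv_empty_ae_eq hf (hg ∅)).symm
  obtain ⟨η, hη, hη2, hηt⟩ := exists_bump_tendsto_one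
  choose φ hφ hφt using fun j => exists_bump_tendsto_dirac (hx j (Set.mem_univ j))
  refine tendsto_nhds_unique
    (tendsto_integral_mul_tensor_dirac hf hfi hx (φ := φ) hφ hφt) ?_
  simp only [fun m => integral_mul_tensor_eq_sum hfi hg (hη m) (φ := fun j => φ j m)
    (fun j => hφ j m)]
  refine tendsto_finsetSum _ fun u _ => ?_
  refine tendsto_integral_of_dominated_convergence (fun y => ‖g u y‖ * 2 ^ d)
    (fun m => (hgi u).aestronglyMeasurable.mul 
      (continuous_testProduct (hη m) (fun j => hφ j m) u).aestronglyMeasurable)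
    ((hgi u).norm.mul_const _) (fun m => Eventually.of_forall fun y => ?_) ?_
  · rw [norm_mul]
    exact mul_le_mul_of_nonneg_left
      (norm_testProduct_le (hη m) (hη2 m) (fun j => hφ j m) u y) (norm_nonneg _)
  · filter_upwards [ae_mem_openCube] with y hy
    refine Tendsto.const_mul _ (tendsto_finsetProd _ fun j _ => ?_)
    have hyj := hy j (Set.mem_univ j)
    split_ifs
    · exact tendsto_primitive_jumpKernel hη hη2 hηt (hφ j) (hφt j) hyj
    · exact hηt _ hyj
end

/-! ### Partial means -/

section
variable {d : ℕ}

/-- Merging the coordinates in `u` of one uniform point with the remaining coordinates of an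
independent one gives a uniform point. -/
lemma measurePreserving_merge (u : Finset (Fin d)) :
    MeasurePreserving (fun (q : (Fin d → ℝ) × (Fin d → ℝ)) j => if j ∈ u then q.1 j else q.2 j)
      ((volume.restrict (LatticeQMC.unitCube d)).prod (volume.restrict (LatticeQMC.unitCube d)))
      (volume.restrict (LatticeQMC.unitCube d)) := by
  have hm : Measurable (fun (q : (Fin d → ℝ) × (Fin d → ℝ)) (j : Fin d) =>
      if j ∈ u then q.1 j else q.2 j) := by
    refine measurable_pi_lambda _ fun j => ?_
    split_ifs
    · exact (measurable_pi_apply j).comp measurable_fst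
    · exact (measurable_pi_apply j).comp measurable_snd
  refine ⟨hm, ?_⟩
  rw [restrict_unitCube]
  refine (Measure.pi_eq fun s hs => ?_).symm
  rw [Measure.map_apply hm (MeasurableSet.univ_pi hs)]
  have hpre : (fun (q : (Fin d → ℝ) × (Fin d → ℝ)) (j : Fin d) =>
      if j ∈ u then q.1 j else q.2 j) ⁻¹' (Set.univ.pi s) =
      (Set.univ.pi fun j => if j ∈ u then s j else Set.univ) ×ˢ
        (Set.univ.pi fun j => if j ∈ u then Set.univ else s j) := by
    ext q
    simp only [Set.mem_preimage, Set.mem_pi, Set.mem_univ, forall_true_left, Set.mem_prod]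
    rw [← forall_and]
    refine forall_congr' fun j => ?_
    split_ifs <;> simp
  rw [hpre, Measure.prod_prod, Measure.pi_pi, Measure.pi_pi, ← Finset.prod_mul_distrib]
  refine Finset.prod_congr rfl fun j _ => ?_
  split_ifs <;> simp

/-- Against functions of the coordinates in `u` alone, `partialMean u g` integrates like `g`. -/
lemma integral_partialMean_mul {u : Finset (Fin d)} {g h : (Fin d → ℝ) → ℝ}
    (hgh : IntegrableOn (fun y => g y * h y) (LatticeQMC.unitCube d))
    (hh : ∀ x y : Fin d → ℝ, h (fun j => if j ∈ u then x j else y j) = h x) :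
    ∫ x in LatticeQMC.unitCube d, LatticeQMC.partialMean u g x * h x =
      ∫ y in LatticeQMC.unitCube d, g y * h y := by
  have hmp := measurePreserving_merge u
  have h1 := integral_map hmp.measurable.aemeasurable
    (f := fun y => g y * h y) (by rw [hmp.map_eq]; exact hgh.aestronglyMeasurable)
  rw [hmp.map_eq] at h1
  rw [h1, integral_prod _ (by exact hmp.integrable_comp_of_integrable hgh)]
  simp only [hh, integral_mul_const]
  rfl

lemma memLp_partialMean {u : Finset (Fin d)} {g : (Fin d → ℝ) → ℝ}
    (hg : MemLp g 2 (volume.restrict (LatticeQMC.unitCube d))) :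
    MemLp (LatticeQMC.partialMean u g) 2 (volume.restrict (LatticeQMC.unitCube d)) := by
  have hG := hg.comp_measurePreserving (measurePreserving_merge u)
  have hG1 := hG.integrable (by norm_num)
  have hG2 := hG.integrable_sq
  have hmeas : AEStronglyMeasurable (LatticeQMC.partialMean u g)
      (volume.restrict (LatticeQMC.unitCube d)) :=
    hG.aestronglyMeasurable.integral_prod_right'
  rw [memLp_two_iff_integrable_sq hmeas]
  refine hG2.integral_prod_left.mono' (hmeas.pow 2) ?_
  filter_upwards [hG1.prod_right_ae, hG2.prod_right_ae] with x hx1 hx2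
  rw [Real.norm_of_nonneg (sq_nonneg _)]
  exact (even_two.convexOn_pow (𝕜 := ℝ)).map_integral_le (continuous_pow 2).continuousOn
    isClosed_univ (Eventually.of_forall fun _ => Set.mem_univ _) hx1 hx2

/-! ### Cauchy-Schwarz bound for the error -/

lemma sq_integral_mul_le {α : Type*} [MeasurableSpace α] {μ : Measure α} {P R : α → ℝ}
    (hP : MemLp P 2 μ) (hR : MemLp R 2 μ) :
    (∫ x, P x * R x ∂μ) ^ 2 ≤ (∫ x, P x ^ 2 ∂μ) * ∫ x, R x ^ 2 ∂μ := by
  have hPR : Integrable (fun x => P x * R x) μ := hP.integrable_mul hR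
  have h := discrim_le_zero (a := ∫ x, P x ^ 2 ∂μ) (b := 2 * ∫ x, P x * R x ∂μ)
    (c := ∫ x, R x ^ 2 ∂μ) (fun t => ?_)
  · unfold discrim at h; linarith
  · have h1 : 0 ≤ ∫ x, (t * P x + R x) ^ 2 ∂μ := integral_nonneg fun x => sq_nonneg _
    have h2 : ∀ x, (t * P x + R x) ^ 2 = t * t * P x ^ 2 + 2 * t * (P x * R x) + R x ^ 2 :=
      fun x => by ring
    simp only [h2] at h1
    rw [integral_add (by exact (hP.integrable_sq.const_mul _).add (hPR.const_mul _))
      hR.integrable_sq, integral_add (hP.integrable_sq.const_mul _) (hPR.const_mul _),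
      integral_const_mul, integral_const_mul] at h1
    linarith

/-- The component along `u` of the representer of the equal-weight rule with nodes `x i`. -/
noncomputable def ruleKernel (n : ℕ) (x : ℕ → Fin d → ℝ) (u : Finset (Fin d))
    (y : Fin d → ℝ) : ℝ :=
  1 / (n : ℝ) * ∑ i ∈ Finset.range n, ∏ j, (if j ∈ u then jumpKernel (x i j) (y j) else 1)

/-- The squared `L²` norm of `ruleKernel n x u`, a mean over pairs of nodes. -/
noncomputable def kernelMean (n : ℕ) (x : ℕ → Fin d → ℝ) (u : Finset (Fin d)) : ℝ :=
  1 / (n : ℝ) ^ 2 * ∑ i ∈ Finset.range n, ∑ k ∈ Finset.range n,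
    ∏ j, (if j ∈ u then sobolevKernel (x i j) (x k j) else 1)

lemma measurable_prod_jumpKernel (u : Finset (Fin d)) (x : Fin d → ℝ) :
    Measurable fun y : Fin d → ℝ => ∏ j, (if j ∈ u then jumpKernel (x j) (y j) else 1) := by
  refine Finset.measurable_prod _ fun j _ => ?_
  split_ifs
  · exact (measurable_jumpKernel _).comp (measurable_pi_apply j)
  · exact measurable_const

lemma norm_prod_jumpKernel_le (u : Finset (Fin d)) (x : Fin d → ℝ) {y : Fin d → ℝ}
    (hy : y ∈ LatticeQMC.unitCube d) :
    ‖∏ j, (if j ∈ u then jumpKernel (x j) (y j) else 1)‖ ≤ 1 := by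
  rw [norm_prod]
  refine Finset.prod_le_one (fun j _ => norm_nonneg _) fun j _ => ?_
  split_ifs
  · exact abs_jumpKernel_le_one (hy j (Set.mem_univ j))
  · simp

lemma memLp_prod_jumpKernel (u : Finset (Fin d)) (x : Fin d → ℝ) :
    MemLp (fun y : Fin d → ℝ => ∏ j, (if j ∈ u then jumpKernel (x j) (y j) else 1)) 2
      (volume.restrict (LatticeQMC.unitCube d)) := by
  refine MemLp.of_bound (measurable_prod_jumpKernel u x).aestronglyMeasurable 1 ?_
  filter_upwards [ae_restrict_mem measurableSet_unitCube] with y hy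
  exact norm_prod_jumpKernel_le u x hy

lemma memLp_ruleKernel (n : ℕ) (x : ℕ → Fin d → ℝ) (u : Finset (Fin d)) :
    MemLp (ruleKernel n x u) 2 (volume.restrict (LatticeQMC.unitCube d)) :=
  (memLp_finsetSum _ fun i _ => memLp_prod_jumpKernel u (x i)).const_mul _

lemma integral_ruleKernel_sq {n : ℕ} {x : ℕ → Fin d → ℝ}
    (hx : ∀ i, x i ∈ LatticeQMC.unitCube d) (u : Finset (Fin d)) :
    ∫ y in LatticeQMC.unitCube d, ruleKernel n x u y ^ 2 = kernelMean n x u := by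
  have h1 : ∀ y, ruleKernel n x u y ^ 2 = 1 / (n : ℝ) ^ 2 * ∑ i ∈ Finset.range n,
      ∑ k ∈ Finset.range n, (∏ j, (if j ∈ u then jumpKernel (x i j) (y j) else 1)) *
        ∏ j, (if j ∈ u then jumpKernel (x k j) (y j) else 1) := by
    intro y
    rw [ruleKernel, mul_pow, pow_two (∑ i ∈ _, _), Finset.sum_mul_sum, div_pow, one_pow]
  have hint : ∀ i k, IntegrableOn (fun y : Fin d → ℝ =>
      (∏ j, (if j ∈ u then jumpKernel (x i j) (y j) else 1)) *
        ∏ j, (if j ∈ u then jumpKernel (x k j) (y j) else 1)) (LatticeQMC.unitCube d) :=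
    fun i k => (memLp_prod_jumpKernel u (x i)).integrable_mul (memLp_prod_jumpKernel u (x k))
  simp only [h1]
  rw [integral_const_mul, kernelMean,
    integral_finsetSum _ fun i _ => integrable_finsetSum _ fun k _ => hint i k]
  congr 1
  refine Finset.sum_congr rfl fun i _ => ?_
  rw [integral_finsetSum _ fun k _ => hint i k]
  refine Finset.sum_congr rfl fun k _ => ?_
  simp only [← Finset.prod_mul_distrib]
  rw [restrict_unitCube, integral_fintype_prod_eq_prod (fun j t =>
    (if j ∈ u then jumpKernel (x i j) t else 1) * (if j ∈ u then jumpKernel (x k j) t else 1))]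
  refine Finset.prod_congr rfl fun j _ => ?_
  split_ifs
  · exact integral_jumpKernel_mul (hx i j (Set.mem_univ j)) (hx k j (Set.mem_univ j))
  · simp

lemma kernelMean_nonneg {n : ℕ} {x : ℕ → Fin d → ℝ}
    (hx : ∀ i, x i ∈ LatticeQMC.unitCube d) (u : Finset (Fin d)) : 0 ≤ kernelMean n x u := by
  rw [← integral_ruleKernel_sq hx]
  exact integral_nonneg fun y => sq_nonneg _

/-- The integration error as a pairing of the mixed derivatives with the representer. -/
lemma rule_sub_integral_eq {f : (Fin d → ℝ) → ℝ}
    (hf : ContinuousOn f (LatticeQMC.unitCube d)) {g : Finset (Fin d) → (Fin d → ℝ) → ℝ}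
    (hg : ∀ u, LatticeQMC.IsWeakMixedDeriv u f (g u)) {n : ℕ} (hn : n ≠ 0)
    {x : ℕ → Fin d → ℝ} (hx : ∀ i, x i ∈ LatticeQMC.unitCube d) :
    1 / (n : ℝ) * ∑ i ∈ Finset.range n, f (x i) - ∫ y in LatticeQMC.unitCube d, f y =
      ∑ u : Finset (Fin d) with u.Nonempty, ∫ y in LatticeQMC.unitCube d,
        LatticeQMC.partialMean u (g u) y * ruleKernel n x u y := by
  have hn' : (n : ℝ) ≠ 0 := by exact_mod_cast hn
  have hint : ∀ (u : Finset (Fin d)) i, IntegrableOn (fun y : Fin d → ℝ => g u y *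
      ∏ j, (if j ∈ u then jumpKernel (x i j) (y j) else 1)) (LatticeQMC.unitCube d) :=
    fun u i => (hg u).1.integrable_mul (memLp_prod_jumpKernel u (x i))
  have h1 : 1 / (n : ℝ) * ∑ i ∈ Finset.range n, f (x i) =
      ∑ u : Finset (Fin d), ∫ y in LatticeQMC.unitCube d, g u y * ruleKernel n x u y := by
    rw [Finset.sum_congr rfl fun i _ => eq_sum_integral_weakDeriv hf hg (hx i), Finset.sum_comm,
      Finset.mul_sum]
    refine Finset.sum_congr rfl fun u _ => ?_
    rw [← integral_finsetSum _ fun i _ => hint u i, ← integral_const_mul]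
    refine integral_congr_ae (ae_of_all _ fun y => ?_)
    simp only [ruleKernel]
    rw [← Finset.mul_sum]
    ring
  have h2 : ∫ y in LatticeQMC.unitCube d, g ∅ y * ruleKernel n x ∅ y =
      ∫ y in LatticeQMC.unitCube d, f y := by
    rw [integral_congr_ae (weakDeriv_empty_ae_eq hf (hg ∅))]
    refine integral_congr_ae (ae_of_all _ fun y => ?_)
    simp [ruleKernel, hn']
  have h3 : (Finset.univ.filter fun u : Finset (Fin d) => u.Nonempty) = Finset.univ.erase ∅ := by
    ext u; simp [Finset.nonempty_iff_ne_empty]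
  rw [h1, ← Finset.add_sum_erase _ _ (Finset.mem_univ ∅), h2, add_sub_cancel_left, h3]
  refine Finset.sum_congr rfl fun u _ => (integral_partialMean_mul
    ((hg u).1.integrable_mul (memLp_ruleKernel n x u)) fun a b => ?_).symm
  unfold ruleKernel
  congr 1
  refine Finset.sum_congr rfl fun i _ => Finset.prod_congr rfl fun j _ => ?_
  by_cases hj : j ∈ u <;> simp [hj]

/-- The worst-case error bound for an arbitrary equal-weight rule. -/
lemma abs_integral_sub_rule_le {γ : Finset ℕ → ℝ} (hγ : ∀ u, 0 ≤ γ u) {f : (Fin d → ℝ) → ℝ}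
    (hf : LatticeQMC.MemSobolev γ f) (hf1 : LatticeQMC.sobolevNorm γ f ≤ 1) {n : ℕ} (hn : n ≠ 0)
    {x : ℕ → Fin d → ℝ} (hx : ∀ i, x i ∈ LatticeQMC.unitCube d) :
    |(∫ y in LatticeQMC.unitCube d, f y) - 1 / (n : ℝ) * ∑ i ∈ Finset.range n, f (x i)| ≤
      √(∑ u : Finset (Fin d) with u.Nonempty, LatticeQMC.weight γ u * kernelMean n x u) := by
  have hg : ∀ u, LatticeQMC.IsWeakMixedDeriv u f (LatticeQMC.weakMixedDeriv u f) := fun u => by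
    rw [LatticeQMC.weakMixedDeriv, dif_pos (hf.exists_weakDeriv u)]
    exact (hf.exists_weakDeriv u).choose_spec
  have hw : ∀ u : Finset (Fin d), 0 ≤ LatticeQMC.weight γ u := fun u => hγ _
  set A : Finset (Fin d) → ℝ := fun u => ∫ y in LatticeQMC.unitCube d,
    LatticeQMC.partialMean u (LatticeQMC.weakMixedDeriv u f) y ^ 2 with hA
  have hA0 : ∀ u, 0 ≤ A u := fun u => integral_nonneg fun y => sq_nonneg _
  have hterm : ∀ u, |∫ y in LatticeQMC.unitCube d,
      LatticeQMC.partialMean u (LatticeQMC.weakMixedDeriv u f) y * ruleKernel n x u y| ≤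
      √((LatticeQMC.weight γ u)⁻¹ * A u) * √(LatticeQMC.weight γ u * kernelMean n x u) := by
    intro u
    rcases (hw u).eq_or_lt with h0 | h0
    · -- Where the weight vanishes, membership in the space forces the term to vanish.
      have hz := hf.zero_weight u h0.symm
      rw [integral_eq_zero_of_ae, abs_zero]
      · positivity
      · filter_upwards [hz] with y hy
        simp [hy]
    · rw [← Real.sqrt_mul (mul_nonneg (inv_nonneg.2 (hw u)) (hA0 u))]
      refine Real.abs_le_sqrt ?_
      have h1 := sq_integral_mul_le (memLp_partialMean (u := u) (hg u).1) (memLp_ruleKernel n x u)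
      rw [integral_ruleKernel_sq hx] at h1
      refine h1.trans (le_of_eq ?_)
      simp only [hA]
      field_simp
  have hA1 : ∑ u : Finset (Fin d) with u.Nonempty, (LatticeQMC.weight γ u)⁻¹ * A u ≤ 1 := by
    have h1 : ∑ u : Finset (Fin d), (LatticeQMC.weight γ u)⁻¹ * A u ≤ 1 := by
      have := Real.sqrt_le_left zero_le_one |>.1 hf1
      simpa using this
    exact (Finset.sum_le_sum_of_subset_of_nonneg (Finset.filter_subset _ _)
      fun u _ _ => mul_nonneg (inv_nonneg.2 (hw u)) (hA0 u)).trans h1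
  rw [abs_sub_comm, rule_sub_integral_eq hf.continuousOn hg hn hx]
  calc _ ≤ ∑ u : Finset (Fin d) with u.Nonempty,
        √((LatticeQMC.weight γ u)⁻¹ * A u) * √(LatticeQMC.weight γ u * kernelMean n x u) :=
        (Finset.abs_sum_le_sum_abs _ _).trans (Finset.sum_le_sum fun u _ => hterm u)
    _ ≤ √(∑ u : Finset (Fin d) with u.Nonempty, (LatticeQMC.weight γ u)⁻¹ * A u) *
        √(∑ u : Finset (Fin d) with u.Nonempty, LatticeQMC.weight γ u * kernelMean n x u) :=
        Real.sum_sqrt_mul_sqrt_le _ (fun u => mul_nonneg (inv_nonneg.2 (hw u)) (hA0 u))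
          fun u => mul_nonneg (hw u) (kernelMean_nonneg hx u)
    _ ≤ 1 * _ := by
        gcongr
        exact Real.sqrt_le_one.2 hA1
    _ = _ := one_mul _
end

/-! ### Lattice rules averaged over the generating vectors -/

section
variable {d : ℕ}

/-- The bound for the squared worst-case error of the lattice rule. -/
noncomputable def latticeKernelSum (γ : Finset ℕ → ℝ) (n : ℕ) (z : Fin d → ℕ) : ℝ :=
  ∑ u : Finset (Fin d) with u.Nonempty,
    LatticeQMC.weight γ u * kernelMean n (LatticeQMC.latticePoint n z) u

lemma latticePoint_mem_unitCube (n : ℕ) (z : Fin d → ℕ) (i : ℕ) :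
    LatticeQMC.latticePoint n z i ∈ LatticeQMC.unitCube d :=
  fun _ _ => ⟨Int.fract_nonneg _, Int.fract_lt_one _⟩

lemma latticeKernelSum_nonneg {γ : Finset ℕ → ℝ} (hγ : ∀ u, 0 ≤ γ u) (n : ℕ) (z : Fin d → ℕ) :
    0 ≤ latticeKernelSum γ n z :=
  Finset.sum_nonneg fun u _ => mul_nonneg (hγ _)
    (kernelMean_nonneg (latticePoint_mem_unitCube n z) u)

lemma worstCaseError_le {γ : Finset ℕ → ℝ} (hγ : ∀ u, 0 ≤ γ u) {n : ℕ} (hn : n ≠ 0)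
    (z : Fin d → ℕ) :
    LatticeQMC.worstCaseError γ n z ≤ ENNReal.ofReal (√(latticeKernelSum γ n z)) :=
  iSup_le fun f => ENNReal.ofReal_le_ofReal
    (abs_integral_sub_rule_le hγ f.2.1 f.2.2 hn (latticePoint_mem_unitCube n z))

lemma latticePoint_apply_eq_val {n : ℕ} [NeZero n] (z : Fin d → ℕ) (i : ℕ) (j : Fin d) :
    LatticeQMC.latticePoint n z i j = (((i : ZMod n) * (z j : ZMod n)).val : ℝ) / n := by
  rw [LatticeQMC.latticePoint, ← Nat.cast_mul, ← Nat.cast_mul, ZMod.val_natCast,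
    Int.fract_div_natCast_eq_div_natCast_mod]

lemma sum_range_natCast_zmod {n : ℕ} [NeZero n] {M : Type*} [AddCommMonoid M] (F : ZMod n → M) :
    ∑ i ∈ Finset.range n, F (i : ZMod n) = ∑ a : ZMod n, F a := by
  rw [← sum_zmod_val (fun i => F (i : ZMod n))]
  simp

lemma sum_Icc_natCast_zmod {n : ℕ} [NeZero n] (F : ZMod n → ℝ) :
    ∑ i ∈ Finset.Icc 1 (n - 1), F (i : ZMod n) =
      ∑ a ∈ Finset.univ.erase (0 : ZMod n), F a := by
  have h1 := Finset.add_sum_erase Finset.univ F (Finset.mem_univ (0 : ZMod n))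
  have h2 : Finset.range n = insert 0 (Finset.Icc 1 (n - 1)) := by
    have := NeZero.pos n
    ext i; simp only [Finset.mem_range, Finset.mem_insert, Finset.mem_Icc]; omega
  rw [← sum_range_natCast_zmod, h2, Finset.sum_insert (by simp), Nat.cast_zero] at h1
  linarith

/-- Averaging over the generating vectors factorizes over the coordinates. -/
lemma sum_generatingVectors_prod {n : ℕ} (hn : 2 ≤ n) (u : Finset (Fin d)) (G : ℕ → ℝ) :
    ∑ z ∈ LatticeQMC.generatingVectors d n, ∏ j, (if j ∈ u then G (z j) else 1) =
      ((n : ℝ) - 1) ^ d * ((∑ v ∈ Finset.Icc 1 (n - 1), G v) / ((n : ℝ) - 1)) ^ u.card := by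
  have hn1 : (n : ℝ) - 1 ≠ 0 := by
    have : (2 : ℝ) ≤ n := by exact_mod_cast hn
    intro h; linarith
  rw [LatticeQMC.generatingVectors,
    ← Finset.prod_univ_sum (fun _ => Finset.Icc 1 (n - 1)) (fun j v => if j ∈ u then G v else 1)]
  have h1 : ∀ j : Fin d, ∑ v ∈ Finset.Icc 1 (n - 1), (if j ∈ u then G v else 1) =
      ((n : ℝ) - 1) * if j ∈ u then (∑ v ∈ Finset.Icc 1 (n - 1), G v) / ((n : ℝ) - 1) else 1 := by
    intro j
    split_ifs
    · field_simp
    · simp [Nat.cast_sub (by omega : 1 ≤ n)]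
  simp only [h1]
  rw [Finset.prod_mul_distrib, Finset.prod_const, Finset.prod_ite_mem, Finset.univ_inter,
    Finset.prod_const, Finset.card_univ, Fintype.card_fin]

lemma sum_kernelMean {n : ℕ} [NeZero n] (hn : 2 ≤ n) (u : Finset (Fin d)) :
    ∑ z ∈ LatticeQMC.generatingVectors d n, kernelMean n (LatticeQMC.latticePoint n z) u =
      ((n : ℝ) - 1) ^ d *
        ((∑ i : ZMod n, ∑ k : ZMod n, meanKernel n i k ^ u.card) / (n : ℝ) ^ 2) := by
  simp only [kernelMean, latticePoint_apply_eq_val]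
  rw [← Finset.mul_sum, Finset.sum_comm]
  have h1 : ∀ i k : ℕ, ∑ z ∈ LatticeQMC.generatingVectors d n,
      ∏ j, (if j ∈ u then sobolevKernel ((((i : ZMod n) * (z j : ZMod n)).val : ℝ) / n)
        ((((k : ZMod n) * (z j : ZMod n)).val : ℝ) / n) else 1) =
      ((n : ℝ) - 1) ^ d * meanKernel n i k ^ u.card := by
    intro i k
    have h3 := sum_Icc_natCast_zmod (fun a : ZMod n =>
      sobolevKernel ((((i : ZMod n) * a).val : ℝ) / n) ((((k : ZMod n) * a).val : ℝ) / n))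
    have h4 := sum_generatingVectors_prod hn u (fun v =>
      sobolevKernel ((((i : ZMod n) * (v : ZMod n)).val : ℝ) / n)
        ((((k : ZMod n) * (v : ZMod n)).val : ℝ) / n))
    beta_reduce at h3 h4
    rw [h4, h3, meanKernel]
  have h2 : ∀ i : ℕ, ∑ z ∈ LatticeQMC.generatingVectors d n, ∑ k ∈ Finset.range n,
      ∏ j, (if j ∈ u then sobolevKernel ((((i : ZMod n) * (z j : ZMod n)).val : ℝ) / n)
        ((((k : ZMod n) * (z j : ZMod n)).val : ℝ) / n) else 1) =
      ∑ k : ZMod n, ((n : ℝ) - 1) ^ d * meanKernel n i k ^ u.card := by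
    intro i
    rw [Finset.sum_comm, ← sum_range_natCast_zmod]
    exact Finset.sum_congr rfl fun k _ => h1 i k
  rw [Finset.sum_congr rfl fun i _ => h2 i, sum_range_natCast_zmod (fun i : ZMod n =>
    ∑ k : ZMod n, ((n : ℝ) - 1) ^ d * meanKernel n i k ^ u.card)]
  simp only [← Finset.mul_sum]
  ring

lemma weightedSum_eq (γ : Finset ℕ → ℝ) (d : ℕ) :
    LatticeQMC.weightedSum γ d = ∑ u : Finset (Fin d) with u.Nonempty,
      LatticeQMC.weight γ u * LatticeQMC.boundConst u.card := by
  unfold LatticeQMC.weightedSum LatticeQMC.weight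
  symm
  refine Finset.sum_bij (fun u _ => u.map Fin.valEmbedding) (fun u hu => ?_)
    (fun u _ v _ h => Finset.map_injective _ h) (fun v hv => ?_) (fun u _ => ?_)
  · simp only [Finset.mem_filter, Finset.mem_univ, true_and] at hu
    simp only [Finset.mem_filter, Finset.mem_powerset, Finset.map_nonempty, hu, and_true]
    intro i hi
    obtain ⟨j, _, rfl⟩ := Finset.mem_map.1 hi
    exact Finset.mem_range.2 j.2
  · simp only [Finset.mem_filter, Finset.mem_powerset] at hv
    have hv' : ∀ i ∈ v, i < d := fun i hi => Finset.mem_range.1 (hv.1 hi)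
    refine ⟨v.attachFin hv', ?_, Finset.map_valEmbedding_attachFin hv'⟩
    simp only [Finset.mem_filter, Finset.mem_univ, true_and]
    rw [← Finset.map_nonempty (f := Fin.valEmbedding), Finset.map_valEmbedding_attachFin hv']
    exact hv.2
  · rw [Finset.card_map]

lemma sum_latticeKernelSum_le {γ : Finset ℕ → ℝ} (hγ : ∀ u, 0 ≤ γ u) (d : ℕ) {n : ℕ}
    (hn : n.Prime) (hn3 : 3 ≤ n) :
    ∑ z ∈ LatticeQMC.generatingVectors d n, latticeKernelSum γ n z ≤
      ((n : ℝ) - 1) ^ d * (Real.log n / √n * LatticeQMC.weightedSum γ d) := by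
  have : Fact n.Prime := ⟨hn⟩
  have : NeZero n := ⟨hn.ne_zero⟩
  have h0 : (0 : ℝ) ≤ ((n : ℝ) - 1) ^ d :=
    pow_nonneg (by have : (3 : ℝ) ≤ n := by exact_mod_cast hn3
                   linarith) _
  unfold latticeKernelSum
  rw [Finset.sum_comm, weightedSum_eq, Finset.mul_sum, Finset.mul_sum]
  refine Finset.sum_le_sum fun u hu => ?_
  have hu' : u.card ≠ 0 := (Finset.card_pos.2 (Finset.mem_filter.1 hu).2).ne'
  rw [← Finset.mul_sum, sum_kernelMean (by omega)]
  have h1 := sum_meanKernel_pow_le (p := n) hn3 hu'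
  calc _ = ((n : ℝ) - 1) ^ d * (LatticeQMC.weight γ u *
        ((∑ i : ZMod n, ∑ k : ZMod n, meanKernel n i k ^ u.card) / (n : ℝ) ^ 2)) := by ring
    _ ≤ ((n : ℝ) - 1) ^ d * (LatticeQMC.weight γ u *
        (Real.log n / √n * LatticeQMC.boundConst u.card)) := by
        gcongr
        exact hγ _
    _ = _ := by ring

lemma card_generatingVectors (d : ℕ) {n : ℕ} (hn : 1 ≤ n) :
    ((LatticeQMC.generatingVectors d n).card : ℝ) = ((n : ℝ) - 1) ^ d := by
  rw [LatticeQMC.generatingVectors, Fintype.card_piFinset]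
  simp [Nat.cast_sub hn]

lemma meanSqError_le {γ : Finset ℕ → ℝ} (hγ : ∀ u, 0 ≤ γ u) (d : ℕ) {n : ℕ}
    (hn : n.Prime) (hn3 : 3 ≤ n) :
    LatticeQMC.meanSqError γ d n ≤
      ENNReal.ofReal (Real.log n / √n * LatticeQMC.weightedSum γ d) := by
  have h0 : (0 : ℝ) < ((n : ℝ) - 1) ^ d :=
    pow_pos (by have : (3 : ℝ) ≤ n := by exact_mod_cast hn3
                linarith) _
  have hcast : (((n - 1 : ℕ) : ℝ≥0∞)) ^ d = ENNReal.ofReal (((n : ℝ) - 1) ^ d) := by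
    rw [ENNReal.ofReal_pow (by have : (3 : ℝ) ≤ n := by exact_mod_cast hn3
                               linarith), ← ENNReal.ofReal_natCast,
      Nat.cast_sub (by omega), Nat.cast_one]
  have hsum : ∑ z ∈ LatticeQMC.generatingVectors d n, LatticeQMC.worstCaseError γ n z ^ 2 ≤
      ENNReal.ofReal (((n : ℝ) - 1) ^ d * (Real.log n / √n * LatticeQMC.weightedSum γ d)) := by
    refine le_trans ?_ (ENNReal.ofReal_le_ofReal (sum_latticeKernelSum_le hγ d hn hn3))
    rw [ENNReal.ofReal_sum_of_nonneg fun z _ => latticeKernelSum_nonneg hγ n z]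
    refine Finset.sum_le_sum fun z _ => ?_
    refine (pow_le_pow_left' (worstCaseError_le hγ hn.ne_zero z) 2).trans (le_of_eq ?_)
    rw [← ENNReal.ofReal_pow (Real.sqrt_nonneg _), Real.sq_sqrt (latticeKernelSum_nonneg hγ n z)]
  rw [LatticeQMC.meanSqError, hcast]
  refine (mul_le_mul_right hsum _).trans (le_of_eq ?_)
  rw [ENNReal.ofReal_mul h0.le, ← mul_assoc, ENNReal.inv_mul_cancel, one_mul]
  · exact (ENNReal.ofReal_pos.2 h0).ne'
  · exact ENNReal.ofReal_ne_top

lemma exists_worstCaseError_le {γ : Finset ℕ → ℝ} (hγ : ∀ u, 0 ≤ γ u) (d : ℕ) {n : ℕ}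
    (hn : n.Prime) (hn3 : 3 ≤ n) :
    ∃ z ∈ LatticeQMC.generatingVectors d n, LatticeQMC.worstCaseError γ n z ≤
      ENNReal.ofReal (√(Real.log n / √n * LatticeQMC.weightedSum γ d)) := by
  have hne : (LatticeQMC.generatingVectors d n).Nonempty :=
    Fintype.piFinset_nonempty.2 fun _ => Finset.nonempty_Icc.2 (by omega)
  have hle : ∑ z ∈ LatticeQMC.generatingVectors d n, latticeKernelSum γ n z ≤
      ∑ _z ∈ LatticeQMC.generatingVectors d n,
        Real.log n / √n * LatticeQMC.weightedSum γ d := by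
    rw [Finset.sum_const, nsmul_eq_mul, card_generatingVectors d (by omega)]
    exact sum_latticeKernelSum_le hγ d hn hn3
  obtain ⟨z, hz, hzle⟩ := Finset.exists_le_of_sum_le hne hle
  exact ⟨z, hz, (worstCaseError_le hγ hn.ne_zero z).trans
    (ENNReal.ofReal_le_ofReal (Real.sqrt_le_sqrt hzle))⟩

/-! ### Infinitely many coordinates -/

lemma weightedSum_le_tsum {γ : Finset ℕ → ℝ} (hγ : ∀ u, 0 ≤ γ u)
    (hs : Summable fun u : Finset ℕ => γ u * LatticeQMC.boundConst u.card) (d : ℕ) :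
    LatticeQMC.weightedSum γ d ≤
      ∑' u : {u : Finset ℕ // u.Nonempty}, γ u.1 * LatticeQMC.boundConst u.1.card := by
  unfold LatticeQMC.weightedSum
  rw [← Finset.sum_subtype_of_mem (p := Finset.Nonempty)
    (fun u : Finset ℕ => γ u * LatticeQMC.boundConst u.card)
    (fun u hu => (Finset.mem_filter.1 hu).2)]
  exact (hs.subtype _).sum_le_tsum _ fun u _ => mul_nonneg (hγ _) (boundConst_pos _).le

lemma sqrt_log_div_sqrt_mul (n : ℕ) {C : ℝ} (hC : 0 ≤ C) (hn : 1 ≤ n) :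
    √(Real.log n / √n * C) = √C * ((n : ℝ) ^ (-(1 / 4) : ℝ) * (Real.log n) ^ (1 / 2 : ℝ)) := by
  have hL : 0 ≤ Real.log n := Real.log_nonneg (by exact_mod_cast hn)
  have hn0 : (0 : ℝ) ≤ n := n.cast_nonneg
  rw [mul_comm, Real.sqrt_mul hC, Real.sqrt_div hL, Real.rpow_neg hn0]
  congr 1
  rw [div_eq_inv_mul]
  congr 1
  · rw [Real.sqrt_eq_rpow, Real.sqrt_eq_rpow, ← Real.rpow_mul hn0]
    norm_num
  · rw [Real.sqrt_eq_rpow]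

/-- For product weights the constants `C_u` are sums of four geometric terms, and a factor
`c ^ |u|` is absorbed into the weights. -/
lemma summable_prod_mul_boundConst_iff {γ : Finset ℕ → ℝ} {g : ℕ → ℝ} (hg : ∀ j, 0 ≤ g j)
    (hγg : ∀ u : Finset ℕ, γ u = ∏ j ∈ u, g j) :
    Summable (fun u : Finset ℕ => γ u * LatticeQMC.boundConst u.card) ↔ Summable g := by
  constructor
  · intro h
    have h1 := h.comp_injective (Finset.singleton_injective (α := ℕ))
    have h2 : (fun u : Finset ℕ => γ u * LatticeQMC.boundConst u.card) ∘ singleton =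
        fun j => g j * LatticeQMC.boundConst 1 := by
      funext j; simp [hγg]
    rw [h2] at h1
    exact (summable_mul_right_iff (boundConst_pos 1).ne').1 h1
  · intro h
    have hgeom : ∀ c : ℝ, 0 ≤ c → Summable fun u : Finset ℕ => γ u * c ^ u.card := by
      intro c hc
      have := summable_finsetProd_of_summable_nonneg (f := fun j => g j * c)
        (fun j => mul_nonneg (hg j) hc) (h.mul_right c)
      refine this.congr fun u => ?_
      rw [Finset.prod_mul_distrib, Finset.prod_const, hγg]
    refine (((((hgeom (1 / 3) (by norm_num)).mul_left 2).add
      (hgeom (1 / 4) (by norm_num))).add ((hgeom (23 / 24) (by norm_num)).mul_left 4)).add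
      (hgeom (3 / Real.pi ^ 2 + 5 / 6) (by positivity))).congr fun u => ?_
    unfold LatticeQMC.boundConst
    simp only [div_pow, one_pow]
    ring
end

theorem theorem2 (γ : Finset ℕ → ℝ) (hγ : ∀ u, 0 ≤ γ u) :
    (∀ d n : ℕ, n.Prime → Odd n →
      LatticeQMC.meanSqError γ d n
          ≤ ENNReal.ofReal (Real.log n / √n * LatticeQMC.weightedSum γ d) ∧
        ∃ z ∈ LatticeQMC.generatingVectors d n,
          LatticeQMC.worstCaseError γ n z
            ≤ ENNReal.ofReal (√(Real.log n / √n * LatticeQMC.weightedSum γ d))) ∧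
    (Summable (fun u : Finset ℕ => γ u * LatticeQMC.boundConst u.card) →
      ∀ d n : ℕ, n.Prime → Odd n →
        ∃ z ∈ LatticeQMC.generatingVectors d n,
          LatticeQMC.worstCaseError γ n z
            ≤ ENNReal.ofReal
                (√(∑' u : {u : Finset ℕ // u.Nonempty}, γ u.1 * LatticeQMC.boundConst u.1.card)
                  * ((n : ℝ) ^ (-(1 / 4) : ℝ) * (Real.log n) ^ (1 / 2 : ℝ)))) ∧
    (∀ g : ℕ → ℝ, (∀ j, 0 ≤ g j) → (∀ u : Finset ℕ, γ u = ∏ j ∈ u, g j) →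
      (Summable (fun u : Finset ℕ => γ u * LatticeQMC.boundConst u.card) ↔ Summable g)) := by
  have h3 : ∀ n : ℕ, n.Prime → Odd n → 3 ≤ n := fun n hn hodd => by
    have h2 := hn.two_le
    rcases hodd with ⟨k, hk⟩
    omega
  refine ⟨fun d n hn hodd => ⟨meanSqError_le hγ d hn (h3 n hn hodd),
    exists_worstCaseError_le hγ d hn (h3 n hn hodd)⟩, fun hs d n hn hodd => ?_,
    fun g hg hγg => summable_prod_mul_boundConst_iff hg hγg⟩
  obtain ⟨z, hz, hzle⟩ := exists_worstCaseError_le hγ d hn (h3 n hn hodd)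
  refine ⟨z, hz, hzle.trans (ENNReal.ofReal_le_ofReal ?_)⟩
  have hC := tsum_nonneg (L := .unconditional _) fun u : {u : Finset ℕ // u.Nonempty} =>
    mul_nonneg (hγ u.1) (boundConst_pos u.1.card).le
  rw [← sqrt_log_div_sqrt_mul n hC hn.one_le]
  refine Real.sqrt_le_sqrt (mul_le_mul_of_nonneg_left (weightedSum_le_tsum hγ hs d) ?_)
  exact div_nonneg (Real.log_nonneg (by exact_mod_cast hn.one_le)) (Real.sqrt_nonneg _)
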